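/- All graphs are finite and loopless and may contain parallel edges. A $2$-edge-coloured graph is a graph together with a map $\phi:E\to\{1,2\}$. A walk is alternating if any two consecutive edges have different colours; for a closed walk it is moreover required that it has at least one edge and that its first and last edge have different colours. A trail is a walk without repeated edges, a path is a walk without repeated vertices. Let $G$ be a $2$-edge-coloured complete graph on $n>1$ vertices $v_1,\dots,v_n$ (any two distinct vertices are joined by at least one edge), and let $p_1,\dots,p_n\ge 1$ be integers. Let $H=G[I_{p_1},\dots,I_{p_n}]$ be the extension of $G$ obtained by replacing each vertex $v_i$ by an independent set $I_{p_i}$ of $p_i$ vertices and each edge of colour $c$ between $v_i$ and $v_j$ by edges of colour $c$, one between $x$ and $y$ for every $x\in I_{p_i}$ and $y\in I_{p_j}$. Then $H$ is supereulerian if and only if $H$ has an eulerian factor and is colour-connected. Here a $2$-edge-coloured graph is - supereulerian if it contains a closed alternating trail that visits every vertex; - said to have an eulerian factor if its vertex set can be partitioned into sets $V_1,\dots,V_k$ such that the subgraph induced by each $V_i$ is supereulerian; - colour-connected if for every two distinct vertices $u,v$ there are two alternating $(u,v)$-paths $P_1,P_2$ whose union ($P_1$ from $u$ to $v$, then $P_2$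 backwards from $v$ to $u$) is an alternating closed walk. -/

import Mathlib

open scoped Graph

/-!
Multigraphs are Mathlib's `Graph α β` (vertices in `α`, edges in `β`, parallel edges allowed).
A 2-edge-colouring is a map `φ : β → Fin 2`; only its values on the edges of the graph matter.
-/

namespace TwoEdgeColoured

variable {α β : Type*}

/-- `IsWalk G u p v`: the list `p` of pairs (edge, next vertex) describes a walk of `G`
from `u` to `v`. -/
def IsWalk (G : Graph α β) : α → List (β × α) → α → Prop
  | u, [], v => u ∈ V(G) ∧ u = v
  | u, (e, w) :: p, v => G.IsLink e u w ∧ IsWalk G w p v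

/-- A trail: a walk whose edges are pairwise distinct. -/
def IsTrail (G : Graph α β) (u : α) (p : List (β × α)) (v : α) : Prop :=
  IsWalk G u p v ∧ (p.map Prod.fst).Nodup

/-- A path: a walk whose vertices are pairwise distinct. -/
def IsPath (G : Graph α β) (u : α) (p : List (β × α)) (v : α) : Prop :=
  IsWalk G u p v ∧ (u :: p.map Prod.snd).Nodup

/-- The sequence of colours of the edges of a walk. -/
def colours (φ : β → Fin 2) (p : List (β × α)) : List (Fin 2) :=
  p.map fun s => φ s.1

/-- Consecutive colours are different. -/
def Alternates (l : List (Fin 2)) : Prop :=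
  l.IsChain (· ≠ ·)

/-- Cyclic version, for closed walks: moreover the first and the last colour are different.
This fails for the empty sequence. -/
def AlternatesCyclically (l : List (Fin 2)) : Prop :=
  Alternates l ∧ l.head? ≠ l.getLast?

/-- There is a closed alternating trail (with at least one edge, the first and the last edge having
different colours) that visits every vertex. -/
def Supereulerian (G : Graph α β) (φ : β → Fin 2) : Prop :=
  ∃ (u : α) (p : List (β × α)),
    IsTrail G u p u ∧ AlternatesCyclically (colours φ p) ∧ ∀ v ∈ V(G), v ∈ p.map Prod.snd

/-- Vertex-disjoint induced subgraphs, each supereulerian, that cover all vertices. -/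
def HasEulerianFactor (G : Graph α β) (φ : β → Fin 2) : Prop :=
  ∃ (k : ℕ) (X : Fin k → Set α),
    Pairwise (Function.onFun Disjoint X) ∧ ⋃ i, X i = V(G) ∧
      ∀ i, Supereulerian (G.induce (X i)) φ

/-- Any two distinct vertices `u`, `v` are joined by two alternating `(u,v)`-paths whose union
(the first one from `u` to `v`, then the second one backwards) is an alternating closed walk. -/
def ColourConnected (G : Graph α β) (φ : β → Fin 2) : Prop :=
  ∀ u ∈ V(G), ∀ v ∈ V(G), u ≠ v →
    ∃ p q : List (β × α),
      IsPath G u p v ∧ Alternates (colours φ p) ∧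
      IsPath G u q v ∧ Alternates (colours φ q) ∧
      AlternatesCyclically (colours φ p ++ (colours φ q).reverse)

/-- A complete multigraph: no loops, and any two distinct vertices are joined by at least one
edge. -/
def IsComplete (G : Graph α β) : Prop :=
  G.Loopless ∧ ∀ u ∈ V(G), ∀ v ∈ V(G), u ≠ v → G.Adj u v

/-- The extension of `G` obtained by replacing every vertex `v` by `p v` copies `⟨v, i⟩`.
Every edge `e` of `G` joining `v` and `w` yields one edge `(e, s(x, y))` for every copy `x` of `v`
and every copy `y` of `w`. For loopless `G`, copies of the same vertex are not adjacent. -/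
def extension (G : Graph α β) (p : α → ℕ) :
    Graph (Σ v, Fin (p v)) (β × Sym2 (Σ v, Fin (p v))) where
  vertexSet := {x | x.1 ∈ V(G)}
  IsLink e x y := e.2 = s(x, y) ∧ G.IsLink e.1 x.1 y.1
  isLink_symm := fun _ _ => ⟨fun _ _ h => ⟨h.1.trans Sym2.eq_swap, h.2.symm⟩⟩
  eq_or_eq_of_isLink_of_isLink := fun _ _ _ _ _ h h' => by
    have := h.1.symm.trans h'.1
    rw [Sym2.eq_iff] at this
    exact this.imp And.left And.left
  left_mem_of_isLink := fun _ _ _ h => h.2.left_mem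

/-- The colouring of an extension: every copy of an edge `e` gets the colour of `e`. -/
def extensionColouring (φ : β → Fin 2) (p : α → ℕ) :
    β × Sym2 (Σ v, Fin (p v)) → Fin 2 :=
  fun e => φ e.1

end TwoEdgeColoured

/-!
Take an eulerian factor of `H` in which no two or more trails can be merged into one closed
alternating trail. If two of its trails visit copies of the same vertex, or are joined by parallel
edges of different colours, by an alternating 4-cycle, or by a pair of edges that can be exchanged
with an edge of each trail, then they can be merged. Running through both trails periodically, one
finds that when all of this is excluded, the colour of an edge between them only depends on its end
on one of the two trails, and alternates along it: this trail dominates the other one. A cyclic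
triple of dominations gives an alternating 6-cycle that merges three trails, so some trail `T`
dominates all others, and it does so with the same colours, as otherwise there is a 4-cycle that
merges three trails. An alternating walk that enters `T` from outside arrives at each vertex of `T`
with the colour prescribed by the domination until it uses a chord of `T` which does not respect
these colours, and such a chord allows to merge `T` with any other trail. Colour-connectedness
provides a walk which ends in `T` with the wrong colour, so there is no other trail.

Conversely, walking along a spanning closed alternating trail one gets from any vertex to any other
one, starting with either colour. In an extension of a complete graph such an alternating walk can
be replaced by an alternating path that starts with the same colour.
-/

namespace TwoEdgeColoured

section Walks

variable {α β : Type*} {H : Graph α β} {φ : β → Fin 2} {u v w x y : α} {a b c : Fin 2} {e : β}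
  {p q : List (β × α)}

lemma add_one_add_one (a : Fin 2) : a + 1 + 1 = a := by decide +revert

lemma ne_iff_eq_add_one : a ≠ b ↔ a = b + 1 := by decide +revert

lemma add_one_ne (a : Fin 2) : a + 1 ≠ a := ne_iff_eq_add_one.2 rfl

lemma eq_or_eq_add_one (a b : Fin 2) : a = b ∨ a = b + 1 := by decide +revert

/-- An alternating walk from `u` to `v` whose first edge has colour `a` and which would be continued
beyond `v` with colour `b`. The empty walk is one from `u` to `u` for `a = b`, so that walks can be
concatenated whenever both the vertices and the colours fit, and a closed alternating walk is one
with `u = v` and `a = b`. -/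
def IsAltWalk (H : Graph α β) (φ : β → Fin 2) : α → Fin 2 → List (β × α) → α → Fin 2 → Prop
  | u, a, [], v, b => u ∈ V(H) ∧ u = v ∧ a = b
  | u, a, (e, w) :: p, v, b => H.IsLink e u w ∧ φ e = a ∧ IsAltWalk H φ w (a + 1) p v b

lemma IsAltWalk.left_mem (h : IsAltWalk H φ u a p v b) : u ∈ V(H) := by
  cases p with
  | nil => exact h.1
  | cons d p => exact h.1.left_mem

lemma isAltWalk_append :
    IsAltWalk H φ u a (p ++ q) w c ↔
      ∃ v b, IsAltWalk H φ u a p v b ∧ IsAltWalk H φ v b q w c := by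
  induction p generalizing u a with
  | nil =>
    refine ⟨fun h => ⟨u, a, ⟨h.left_mem, rfl, rfl⟩, h⟩, ?_⟩
    rintro ⟨v, b, ⟨_, rfl, rfl⟩, h⟩
    exact h
  | cons d p ih =>
    constructor
    · rintro ⟨hl, hc, h⟩
      obtain ⟨v, b, hp, hq⟩ := ih.1 h
      exact ⟨v, b, ⟨hl, hc, hp⟩, hq⟩
    · rintro ⟨v, b, ⟨hl, hc, hp⟩, hq⟩
      exact ⟨hl, hc, ih.2 ⟨v, b, hp, hq⟩⟩

lemma IsAltWalk.append (hp : IsAltWalk H φ u a p v b) (hq : IsAltWalk H φ v b q w c) :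
    IsAltWalk H φ u a (p ++ q) w c :=
  isAltWalk_append.2 ⟨v, b, hp, hq⟩

lemma isAltWalk_singleton :
    IsAltWalk H φ u a [(e, w)] v b ↔ w = v ∧ H.IsLink e u w ∧ φ e = a ∧ b = a + 1 :=
  ⟨fun ⟨hl, hc, _, hw, hb⟩ => ⟨hw, hl, hc, hb.symm⟩,
    fun ⟨hw, hl, hc, hb⟩ => ⟨hl, hc, hl.right_mem, hw, hb.symm⟩⟩

lemma IsAltWalk.concat (hp : IsAltWalk H φ u a p v b) (he : H.IsLink e v w) (hb : φ e = b) :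
    IsAltWalk H φ u a (p ++ [(e, w)]) w (b + 1) :=
  hp.append (isAltWalk_singleton.2 ⟨rfl, he, hb, rfl⟩)

lemma IsAltWalk.right_mem_support (h : IsAltWalk H φ u a p v b) : v ∈ u :: p.map Prod.snd := by
  induction p generalizing u a with
  | nil => exact List.mem_singleton.2 h.2.1.symm
  | cons d p ih => exact List.mem_cons_of_mem _ (ih h.2.2)

lemma IsAltWalk.mem_vertexSet (h : IsAltWalk H φ u a p v b) (hx : x ∈ u :: p.map Prod.snd) :
    x ∈ V(H) := by
  induction p generalizing u a with
  | nil => exact List.mem_singleton.1 hx ▸ h.1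
  | cons d p ih =>
    rcases List.mem_cons.1 hx with rfl | hx
    · exact h.left_mem
    · exact ih h.2.2 hx

lemma IsAltWalk.exists_isLink (h : IsAltWalk H φ u a p v b) (he : e ∈ p.map Prod.fst) :
    ∃ x ∈ u :: p.map Prod.snd, ∃ y ∈ p.map Prod.snd, H.IsLink e x y := by
  induction p generalizing u a with
  | nil => simp at he
  | cons d p ih =>
    rcases List.mem_cons.1 he with rfl | he
    · exact ⟨u, by simp, d.2, by simp, h.1⟩
    · obtain ⟨x, hx, y, hy, hl⟩ := ih h.2.2 he
      exact ⟨x, List.mem_cons_of_mem _ hx, y, List.mem_cons_of_mem _ hy, hl⟩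

lemma IsAltWalk.left_mem_support_of_isLink (h : IsAltWalk H φ u a p v b)
    (he : e ∈ p.map Prod.fst) (hl : H.IsLink e x y) : x ∈ u :: p.map Prod.snd := by
  obtain ⟨s, hs, t, ht, hl'⟩ := h.exists_isLink he
  obtain ⟨rfl, -⟩ | ⟨rfl, -⟩ := hl.eq_and_eq_or_eq_and_eq hl'
  exacts [hs, List.mem_cons_of_mem _ ht]

lemma IsAltWalk.exists_append_of_mem_support (h : IsAltWalk H φ u a p v b)
    (hx : x ∈ u :: p.map Prod.snd) :
    ∃ s t c, p = s ++ t ∧ IsAltWalk H φ u a s x c ∧ IsAltWalk H φ x c t v b := by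
  induction p generalizing u a with
  | nil => obtain rfl := List.mem_singleton.1 hx; exact ⟨[], [], a, rfl, ⟨h.1, rfl, rfl⟩, h⟩
  | cons d p ih =>
    rcases List.mem_cons.1 hx with rfl | hx
    · exact ⟨[], d :: p, a, rfl, ⟨h.left_mem, rfl, rfl⟩, h⟩
    · obtain ⟨s, t, c, rfl, hs, ht⟩ := ih h.2.2 hx
      exact ⟨d :: s, t, c, rfl, ⟨h.1, h.2.1, hs⟩, ht⟩

lemma IsAltWalk.nodup_edges_of_nodup_vertices (h : IsAltWalk H φ u a p v b)
    (hn : (u :: p.map Prod.snd).Nodup) : (p.map Prod.fst).Nodup := by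
  induction p generalizing u a with
  | nil => exact List.nodup_nil
  | cons d p ih =>
    obtain ⟨hu, hn⟩ := List.nodup_cons.1 hn
    exact List.nodup_cons.2 ⟨fun hd => hu (h.2.2.left_mem_support_of_isLink hd h.1), ih h.2.2 hn⟩

/-- The walk `p` starting in `u`, traversed backwards. -/
def reverseWalk : α → List (β × α) → List (β × α)
  | _, [] => []
  | u, (e, w) :: p => reverseWalk w p ++ [(e, u)]

lemma map_fst_reverseWalk (u : α) (p : List (β × α)) :
    (reverseWalk u p).map Prod.fst = (p.map Prod.fst).reverse := by
  induction p generalizing u with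
  | nil => rfl
  | cons d p ih => simp [reverseWalk, ih]

lemma colours_reverseWalk (φ : β → Fin 2) (u : α) (p : List (β × α)) :
    colours φ (reverseWalk u p) = (colours φ p).reverse := by
  have hcolours : ∀ q : List (β × α), colours φ q = (q.map Prod.fst).map φ := fun q => by
    rw [List.map_map]
    rfl
  rw [hcolours, hcolours, map_fst_reverseWalk, List.map_reverse]

lemma IsAltWalk.reverse (h : IsAltWalk H φ u a p v b) :
    IsAltWalk H φ v (b + 1) (reverseWalk u p) u (a + 1) := by
  induction p generalizing u a with
  | nil => obtain ⟨h, rfl, rfl⟩ := h; exact ⟨h, rfl, rfl⟩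
  | cons d p ih =>
    have hrev := ih h.2.2
    rw [add_one_add_one] at hrev
    exact hrev.concat h.1.symm h.2.1

lemma IsAltWalk.right_mem (h : IsAltWalk H φ u a p v b) : v ∈ V(H) := h.reverse.left_mem

lemma IsAltWalk.support_reverseWalk (h : IsAltWalk H φ u a p v b) :
    v :: (reverseWalk u p).map Prod.snd = (u :: p.map Prod.snd).reverse := by
  induction p generalizing u a with
  | nil => simp [reverseWalk, h.2.1]
  | cons d p ih =>
    simp only [reverseWalk, List.map_append, ← List.cons_append, ih h.2.2, List.map_cons,
      List.map_nil, List.reverse_cons]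

lemma exists_isAltWalk_iff :
    (∃ b, IsAltWalk H φ u a p v b) ↔ IsWalk H u p v ∧ Alternates ((a + 1) :: colours φ p) := by
  induction p generalizing u a with
  | nil =>
    exact ⟨fun ⟨_, hu, huv, _⟩ => ⟨⟨hu, huv⟩, List.isChain_singleton _⟩,
      fun h => ⟨a, h.1.1, h.1.2, rfl⟩⟩
  | cons d p ih =>
    have hchain : Alternates ((a + 1) :: colours φ (d :: p)) ↔
        φ d.1 = a ∧ Alternates ((a + 1 + 1) :: colours φ p) := by
      rw [add_one_add_one]
      refine List.isChain_cons_cons.trans ⟨fun h => ?_, ?_⟩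
      · have hd : φ d.1 = a := (add_right_cancel (ne_iff_eq_add_one.1 h.1)).symm
        exact ⟨hd, hd ▸ h.2⟩
      · rintro ⟨rfl, h⟩
        exact ⟨add_one_ne _, h⟩
    simp only [IsAltWalk, IsWalk, hchain, exists_and_left, ih]
    tauto

lemma IsAltWalk.isWalk (h : IsAltWalk H φ u a p v b) : IsWalk H u p v :=
  (exists_isAltWalk_iff.1 ⟨b, h⟩).1

lemma IsAltWalk.alternates_colours (h : IsAltWalk H φ u a p v b) : Alternates (colours φ p) :=
  (List.isChain_cons.1 (exists_isAltWalk_iff.1 ⟨b, h⟩).2).2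

lemma exists_isAltWalk (h : IsWalk H u p v) (hp : Alternates (colours φ p)) :
    ∃ a b, IsAltWalk H φ u a p v b := by
  cases p with
  | nil => exact ⟨0, 0, h.1, h.2, rfl⟩
  | cons d p =>
    refine ⟨φ d.1, exists_isAltWalk_iff.2 ⟨h, List.isChain_cons.2 ⟨fun c hc => ?_, hp⟩⟩⟩
    obtain rfl : φ d.1 = c := Option.some.inj hc
    exact add_one_ne _

lemma IsAltWalk.head?_colours (h : IsAltWalk H φ u a p v b) (hp : p ≠ []) :
    (colours φ p).head? = some a := by
  cases p with
  | nil => exact absurd rfl hp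
  | cons d p => exact congrArg some h.2.1

lemma IsAltWalk.getLast?_colours (h : IsAltWalk H φ u a p v b) (hp : p ≠ []) :
    (colours φ p).getLast? = some (b + 1) := by
  obtain ⟨q, ⟨e, w⟩, rfl⟩ := (List.eq_nil_or_concat' p).resolve_left hp
  obtain ⟨x, c, -, hlast⟩ := isAltWalk_append.1 h
  obtain ⟨-, -, rfl, rfl⟩ := isAltWalk_singleton.1 hlast
  simp [colours, add_one_add_one]

lemma IsAltWalk.alternatesCyclically (h : IsAltWalk H φ u a p u a) (hp : p ≠ []) :
    AlternatesCyclically (colours φ p) := by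
  refine ⟨h.alternates_colours, ?_⟩
  rw [h.head?_colours hp, h.getLast?_colours hp]
  exact fun heq => add_one_ne a (Option.some.inj heq).symm

lemma exists_isAltWalk_of_alternatesCyclically (h : IsWalk H u p v)
    (hp : AlternatesCyclically (colours φ p)) : ∃ a, IsAltWalk H φ u a p v a := by
  have hne : p ≠ [] := by
    rintro rfl
    exact hp.2 rfl
  obtain ⟨a, b, hab⟩ := exists_isAltWalk h hp.1
  have hne' : a ≠ b + 1 := fun heq =>
    hp.2 ((hab.head?_colours hne).trans (heq ▸ (hab.getLast?_colours hne).symm))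
  have heq := (eq_or_eq_add_one a b).resolve_right hne'
  exact ⟨b, heq ▸ hab⟩

end Walks

/-- A 2-edge-coloured graph that looks like an extension of a complete graph: `κ` divides the
vertices into classes, two vertices are adjacent if and only if they belong to different classes,
and vertices of the same class are joined to the other vertices by edges of the same colours. -/
structure IsExtendedComplete {α β γ : Type*} (H : Graph α β) (φ : β → Fin 2) (κ : α → γ) :
    Prop where
  ne : ∀ {e x y}, H.IsLink e x y → κ x ≠ κ y
  adj : ∀ {x y}, x ∈ V(H) → y ∈ V(H) → κ x ≠ κ y → H.Adj x y
  twin : ∀ {e x y z}, H.IsLink e x y → z ∈ V(H) → κ z = κ x → ∃ f, H.IsLink f z y ∧ φ f = φ e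

section Paths

variable {α β γ : Type*} {H : Graph α β} {φ : β → Fin 2} {κ : α → γ} {u v w : α} {a b c : Fin 2}
  {e : β} {p : List (β × α)}

lemma IsExtendedComplete.vertex_ne (hH : IsExtendedComplete H φ κ) (h : H.IsLink e u v) : u ≠ v :=
  fun huv => hH.ne h (congrArg κ huv)

/-- There is an alternating path from `u` to `v` whose first edge has colour `a` and which could be
continued with colour `b`; with the conventions of `IsAltWalk`, the empty path is one of them. -/
def HasAltPath (H : Graph α β) (φ : β → Fin 2) (u : α) (a : Fin 2) (v : α) (b : Fin 2) : Prop :=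
  ∃ p, IsAltWalk H φ u a p v b ∧ (u :: p.map Prod.snd).Nodup

lemma HasAltPath.symm (h : HasAltPath H φ u a v b) : HasAltPath H φ v (b + 1) u (a + 1) := by
  obtain ⟨p, hp, hn⟩ := h
  exact ⟨reverseWalk u p, hp.reverse, hp.support_reverseWalk ▸ List.nodup_reverse.2 hn⟩

lemma HasAltPath.eq_of_self (h : HasAltPath H φ u a u b) : a = b := by
  obtain ⟨_ | ⟨d, p⟩, hp, hn⟩ := h
  · exact hp.2.2
  · exact absurd hp.2.2.right_mem_support (List.nodup_cons.1 hn).1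

/-- If `w` is already on the path, then it is cut off at `w`, where its colour either is the desired
one or allows to go directly to its old end. -/
lemma HasAltPath.extend (h : HasAltPath H φ u a v b) (he : H.IsLink e v w) (hb : φ e = b)
    (hvw : v ≠ w) :
    HasAltPath H φ u a w (b + 1) ∨ HasAltPath H φ u a w b ∧ HasAltPath H φ u a v (b + 1) := by
  obtain ⟨p, hp, hn⟩ := h
  by_cases hw : w ∈ u :: p.map Prod.snd
  · obtain ⟨s, t, c, rfl, hs, ht⟩ := hp.exists_append_of_mem_support hw
    rw [List.map_append] at hn
    have hpath : HasAltPath H φ u a w c :=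
      ⟨s, hs, hn.sublist ((List.sublist_append_left _ _).cons_cons u)⟩
    rcases eq_or_eq_add_one c b with rfl | rfl
    · have hv : v ∈ t.map Prod.snd := (List.mem_cons.1 ht.right_mem_support).resolve_left hvw
      refine Or.inr ⟨hpath, s ++ [(e, v)], hs.concat he.symm hb, hn.sublist ?_⟩
      rw [List.map_append]
      exact ((List.Sublist.refl _).append (List.singleton_sublist.2 hv)).cons_cons u
    · exact Or.inl hpath
  · refine Or.inl ⟨p ++ [(e, w)], hp.concat he hb, ?_⟩
    rw [List.map_append, ← List.cons_append]
    exact hn.append (List.nodup_singleton w) (List.disjoint_singleton.2 hw)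

lemma HasAltPath.color_eq_of_forall_not (h : HasAltPath H φ u a v b)
    (hno : ∀ c, ¬ HasAltPath H φ u a w c) (he : H.IsLink e v w) : φ e = b + 1 := by
  have hvw : v ≠ w := fun hvw => hno b (hvw ▸ h)
  refine ne_iff_eq_add_one.1 fun hb => ?_
  rcases h.extend he hb hvw with hw | ⟨hw, -⟩
  · exact hno _ hw
  · exact hno _ hw

lemma IsExtendedComplete.adj_of_hasAltPath (hH : IsExtendedComplete H φ κ) (hw : w ∈ V(H))
    (hno : ∀ c, ¬ HasAltPath H φ u a w c) (h : HasAltPath H φ u a v b) (hvu : v ≠ u) :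
    H.Adj v w := by
  obtain ⟨p, hp, hn⟩ := h
  refine hH.adj hp.right_mem hw fun hκ => ?_
  have hne : p ≠ [] := by rintro rfl; exact hvu hp.2.1.symm
  obtain ⟨q, ⟨e, v'⟩, rfl⟩ := (List.eq_nil_or_concat' p).resolve_left hne
  obtain ⟨y, c, hq, hlast⟩ := isAltWalk_append.1 hp
  obtain ⟨rfl, he, hc, -⟩ := isAltWalk_singleton.1 hlast
  obtain ⟨f, hf, hfe⟩ := hH.twin he.symm hw hκ.symm
  rw [List.map_append, ← List.cons_append] at hn
  have hy : HasAltPath H φ u a y c := ⟨q, hq, hn.of_append_left⟩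
  exact add_one_ne c ((hy.color_eq_of_forall_not hno hf.symm).symm.trans (hfe.trans hc))

/-- If `w` is not reached by an alternating path, then every vertex which is reached has a unique
last colour, and therefore an alternating walk can be followed by paths. -/
theorem IsExtendedComplete.exists_hasAltPath (hH : IsExtendedComplete H φ κ)
    (hp : IsAltWalk H φ u a p w b) : ∃ c, HasAltPath H φ u a w c := by
  by_contra! hno
  have unique : ∀ {v b c}, HasAltPath H φ u a v b → HasAltPath H φ u a v c → b = c := by
    intro v b c hb hc
    rcases eq_or_ne v u with rfl | hvu
    · exact hb.eq_of_self.symm.trans hc.eq_of_self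
    · obtain ⟨e, he⟩ := hH.adj_of_hasAltPath hp.right_mem hno hb hvu
      exact add_right_cancel
        ((hb.color_eq_of_forall_not hno he).symm.trans (hc.color_eq_of_forall_not hno he))
  have follow : ∀ {q v c}, IsAltWalk H φ v c q w b → ¬ HasAltPath H φ u a v c := by
    intro q
    induction q with
    | nil => rintro v c ⟨_, rfl, rfl⟩; exact hno _
    | cons d q ih =>
      rintro v c ⟨hl, hc, hq⟩ hv
      rcases hv.extend hl hc (hH.vertex_ne hl) with hpath | ⟨-, hpath⟩
      · exact ih hq hpath
      · exact add_one_ne c (unique hpath hv)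
  exact follow hp ⟨[], ⟨hp.left_mem, rfl, rfl⟩, List.nodup_singleton u⟩

end Paths

section Patterns

variable {f : ℤ → ℤ → Fin 2} {c d : ℤ → Fin 2} {N : ℤ}

lemma eq_of_monotone_of_periodic {δ : Type*} [PartialOrder δ] {g : ℤ → δ} (hg : Monotone g)
    (hper : Function.Periodic g N) (hN : 0 < N) (i j : ℤ) : g i = g j := by
  have hle : ∀ i j, g i ≤ g j := fun i j =>
    calc g i ≤ g (j + |i - j| * N) := hg (by nlinarith [le_abs_self (i - j), abs_nonneg (i - j)])
      _ = g j := hper.int_mul _ j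
  exact le_antisymm (hle i j) (hle j i)

lemma apply_eq_apply_zero_of_forall_add_one {δ : Type*} {g : ℤ → ℤ → δ}
    (hleft : ∀ i j, g (i + 1) j = g i j) (hright : ∀ i j, g i (j + 1) = g i j) (i j : ℤ) :
    g i j = g 0 0 := by
  have hi : g i j = g 0 j := by
    simpa using Function.Periodic.int_mul_eq (f := (g · j)) (c := 1) (fun k => hleft k j) i
  have hj : g 0 j = g 0 0 := by
    simpa using Function.Periodic.int_mul_eq (f := g 0) (c := 1) (hright 0) j
  exact hi.trans hj

/-- The colours `f i j` of the edges between position `i` of a closed alternating trail and position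
`j` of another one which cannot be merged with it. The positions are counted cyclically with the
common period `N`, and `c i` and `d j` are the colours of the edges of the trails that join position
`i` to `i + 1` and `j` to `j + 1`. The last three fields exclude that two edges of the trails with
the same colour can be exchanged with a pair of parallel or crossing edges of that colour, and that
there is an alternating 4-cycle between the trails. -/
structure IsUnmergeable (f : ℤ → ℤ → Fin 2) (c d : ℤ → Fin 2) (N : ℤ) : Prop where
  pos : 0 < N
  periodic_left : ∀ j, Function.Periodic (f · j) N
  periodic_right : ∀ i, Function.Periodic (f i) N
  periodic_color_left : Function.Periodic c N
  color_left_add_one : ∀ i, c (i + 1) = c i + 1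
  color_right_add_one : ∀ j, d (j + 1) = d j + 1
  parallel : ∀ {i j}, c i = d j → f i j = c i → f (i + 1) (j + 1) ≠ c i
  crossing : ∀ {i j}, c i = d j → f i (j + 1) = c i → f (i + 1) j ≠ c i
  nested : ∀ {i i' j j'}, f i j ≠ f i' j → f i' j ≠ f i' j' → f i' j' = f i j'

namespace IsUnmergeable

/-- The colours along a diagonal agree with those of the trails at all positions or at none: once
they agree they do so forever, hence everywhere by periodicity. -/
lemma apply_add_one_add_one_of_eq (h : IsUnmergeable f c d N) {i j : ℤ} (hij : c i = d j) :
    f (i + 1) (j + 1) = f i j + 1 := by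
  have hcolor : ∀ k, c (i + k) = d (j + k) := fun k => by
    have hper : Function.Periodic (fun k => c (i + k) - d (j + k)) 1 := fun k => by
      simp only [← add_assoc, h.color_left_add_one, h.color_right_add_one, add_sub_add_right_eq_sub]
    simpa [hij, sub_eq_zero] using hper.int_mul_eq k
  let agree (k : ℤ) : Prop := f (i + k) (j + k) = c (i + k)
  have hmono : Monotone agree := monotone_int_of_le_succ fun k hk => by
    simp only [agree, ← add_assoc, h.color_left_add_one]
    exact ne_iff_eq_add_one.1 (h.parallel (hcolor k) hk)
  have hper : Function.Periodic agree N := fun k => by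
    have hleft := h.periodic_left (j + k + N) (i + k)
    simp only [agree, ← add_assoc, h.periodic_color_left (i + k), h.periodic_right (i + k) (j + k),
      hleft]
  have hagree : f (i + 1) (j + 1) = c i + 1 ↔ f i j = c i := by
    have := eq_of_monotone_of_periodic hmono hper h.pos 1 0
    simpa only [agree, add_zero, h.color_left_add_one, eq_iff_iff] using this
  revert hagree
  generalize f (i + 1) (j + 1) = s, f i j = t, c i = r
  decide +revert

/-- The pattern after reversing the second trail. -/
lemma reflect (h : IsUnmergeable f c d N) :
    IsUnmergeable (fun i j => f i (-j)) c (fun j => d (-j) + 1) N := by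
  have hd : ∀ j, d (-j) = d (-(j + 1)) + 1 := fun j => by
    rw [← h.color_right_add_one]; congr 1; ring
  have hneg : ∀ j : ℤ, -(j + 1) + 1 = -j := fun j => by ring
  exact
    { pos := h.pos
      periodic_left := fun j => h.periodic_left (-j)
      periodic_right := fun i j => by
        simp only [neg_add, ← sub_eq_add_neg, (h.periodic_right i).sub_eq]
      periodic_color_left := h.periodic_color_left
      color_left_add_one := h.color_left_add_one
      color_right_add_one := fun j => by rw [hd j, add_one_add_one]
      parallel := fun {i j} hij hf hf' => by
        rw [hd, add_one_add_one] at hij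
        exact h.crossing hij (by rwa [hneg]) hf'
      crossing := fun {i j} hij hf hf' => by
        rw [hd, add_one_add_one] at hij
        exact h.parallel hij hf (by rwa [hneg])
      nested := h.nested }

lemma apply_add_one_sub_one_of_eq (h : IsUnmergeable f c d N) {i j : ℤ} (hij : c i = d j + 1) :
    f (i + 1) (j - 1) = f i j + 1 := by
  simpa [add_comm, sub_eq_add_neg] using
    h.reflect.apply_add_one_add_one_of_eq (i := i) (j := -j) (by simpa using hij)

lemma apply_add_two_of_eq (h : IsUnmergeable f c d N) {i j : ℤ} (hij : c i = d j) :
    f (i + 2) j = f i j := by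
  have hcolor : ∀ k, c i = d (j + 2 * k) := fun k => by
    have hper : Function.Periodic d 2 := fun k => by
      rw [show k + 2 = k + 1 + 1 by ring, h.color_right_add_one, h.color_right_add_one,
        add_one_add_one]
    rw [hij, mul_comm]
    exact (hper.int_mul k j).symm
  have hshift : ∀ k, f (i + 2) (j + 2 * (k + 1)) = f i (j + 2 * k) := fun k => by
    have hnext : c (i + 1) = d (j + 2 * k + 1) := by
      rw [h.color_left_add_one, h.color_right_add_one, hcolor k]
    rw [show i + 2 = i + 1 + 1 by ring, show j + 2 * (k + 1) = j + 2 * k + 1 + 1 by ring,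
      h.apply_add_one_add_one_of_eq hnext, h.apply_add_one_add_one_of_eq (hcolor k),
      add_one_add_one]
  by_contra hne
  have himp : ∀ k, f (i + 2) k = f i j → f i k = f i j := fun k hk =>
    (h.nested (Ne.symm hne) (hk ▸ hne)).symm.trans hk
  have hmono : Monotone fun k => f i (j + 2 * k) = f i j :=
    monotone_int_of_le_succ fun k hk => himp _ ((hshift k).trans hk)
  have hper : Function.Periodic (fun k => f i (j + 2 * k) = f i j) N := fun k => by
    have := (h.periodic_right i).int_mul 2 (j + 2 * k)
    simp only [Int.cast_ofNat, add_assoc, ← mul_add] at this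
    simp only [this]
  have hback : f i (j + 2 * (-1)) = f i j :=
    (eq_of_monotone_of_periodic hmono hper h.pos (-1) 0).mpr (by rw [mul_zero, add_zero])
  refine hne (Eq.trans ?_ hback)
  rw [← hshift, neg_add_cancel, mul_zero, add_zero]

lemma apply_add_two (h : IsUnmergeable f c d N) (i j : ℤ) : f (i + 2) j = f i j := by
  rcases eq_or_eq_add_one (c i) (d j) with hij | hij
  · exact h.apply_add_two_of_eq hij
  · simpa using h.reflect.apply_add_two_of_eq (i := i) (j := -j) (by simpa using hij)

lemma apply_add_one_add_one (h : IsUnmergeable f c d N) (i j : ℤ) :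
    f (i + 1) (j + 1) = f i j + 1 := by
  rcases eq_or_eq_add_one (c i) (d j) with hij | hij
  · exact h.apply_add_one_add_one_of_eq hij
  · have hnext : c (i + 1) = d (j + 1) + 1 := by
      rw [h.color_left_add_one, h.color_right_add_one, hij]
    have := h.apply_add_one_sub_one_of_eq hnext
    rw [add_sub_cancel_right, add_assoc, one_add_one_eq_two, h.apply_add_two] at this
    rw [this, add_one_add_one]

/-- Both `f` and its increments `f (i + 1) j - f i j` are `2`-periodic in `i`, and the increments do
not change along the diagonals. So they are constant, and `f` follows `d` or `c` according to
whether the constant is `0` or `1`. -/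
theorem eq_left_or_eq_right (h : IsUnmergeable f c d N) :
    (∃ a, ∀ i j, f i j = c i + a) ∨ ∃ a, ∀ i j, f i j = d j + a := by
  have hincr : ∀ i j, f (i + 1) j - f i j = f 1 0 - f 0 0 := by
    have hleft : ∀ i j, f (i + 1 + 1) j - f (i + 1) j = f (i + 1) j - f i j := fun i j => by
      rw [add_assoc, one_add_one_eq_two, h.apply_add_two]
      generalize f (i + 1) j = s, f i j = t
      decide +revert
    refine apply_eq_apply_zero_of_forall_add_one hleft fun i j => ?_
    rw [← hleft, h.apply_add_one_add_one, h.apply_add_one_add_one, add_sub_add_right_eq_sub]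
  have hright : ∀ i j, f i (j + 1) + (f 1 0 - f 0 0) = f i j + 1 := fun i j => by
    rw [← hincr i (j + 1), add_sub_cancel, h.apply_add_one_add_one]
  rcases eq_or_eq_add_one (f 1 0 - f 0 0) 0 with h0 | h1
  · right
    simp only [h0, sub_eq_zero, add_zero] at hincr hright
    refine ⟨f 0 0 - d 0, fun i j => ?_⟩
    rw [← apply_eq_apply_zero_of_forall_add_one (g := fun i j => f i j - d j) (fun i j => ?_)
      (fun i j => ?_) i j, add_sub_cancel]
    · rw [hincr]
    · rw [hright, h.color_right_add_one, add_sub_add_right_eq_sub]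
  · left
    simp only [h1, zero_add, sub_eq_iff_eq_add', add_left_inj] at hincr hright
    refine ⟨f 0 0 - c 0, fun i j => ?_⟩
    rw [← apply_eq_apply_zero_of_forall_add_one (g := fun i j => f i j - c i) (fun i j => ?_)
      (fun i j => ?_) i j, add_sub_cancel]
    · rw [hincr, h.color_left_add_one, add_sub_add_right_eq_sub]
    · rw [hright]

end IsUnmergeable

end Patterns

section ClosedTrails

variable {α β : Type*} {H : Graph α β} {φ : β → Fin 2} {u v x x' y y' : α}
  {a b : Fin 2} {e f g g' : β} {p q r : List (β × α)} {X Y : Set α} {F F' : Set β}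

lemma IsAltWalk.right_mem_map_snd (h : IsAltWalk H φ u a p v b) (hp : p ≠ []) :
    v ∈ p.map Prod.snd := by
  cases p with
  | nil => exact absurd rfl hp
  | cons d p => exact h.2.2.right_mem_support

lemma IsAltWalk.nodup_edges_of_cycle (h : IsAltWalk H φ u a p u a) (hn : (p.map Prod.snd).Nodup) :
    (p.map Prod.fst).Nodup := by
  rcases p with _ | ⟨⟨e, w⟩, _ | ⟨⟨e', w'⟩, p⟩⟩
  · exact List.nodup_nil
  · exact List.nodup_singleton e
  · obtain ⟨hl, hc, h⟩ := h
    have hw : w ∉ w' :: p.map Prod.snd := (List.nodup_cons.1 hn).1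
    refine List.nodup_cons.2 ⟨fun he => ?_, h.nodup_edges_of_nodup_vertices hn⟩
    rcases List.mem_cons.1 he with rfl | he
    · exact add_one_ne a (h.2.1.symm.trans hc)
    · obtain ⟨s, hs, t, ht, hl'⟩ := h.2.2.exists_isLink he
      obtain ⟨-, rfl⟩ | ⟨-, rfl⟩ := hl.eq_and_eq_or_eq_and_eq hl'
      · exact hw (List.mem_cons_of_mem _ ht)
      · exact hw hs

/-- `p` is a closed alternating trail of `H` that starts in `u` with colour `a`; `X` is its set of
vertices and `F` its set of edges. -/
structure IsClosedTrail (H : Graph α β) (φ : β → Fin 2) (u : α) (a : Fin 2) (p : List (β × α))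
    (X : Set α) (F : Set β) : Prop where
  ne_nil : p ≠ []
  walk : IsAltWalk H φ u a p u a
  nodup : (p.map Prod.fst).Nodup
  mem_vertices : ∀ w, w ∈ p.map Prod.snd ↔ w ∈ X
  mem_edges : ∀ e, e ∈ p.map Prod.fst ↔ e ∈ F

/-- `X` and `F` are the vertex set and the edge set of a closed alternating trail of `H`. -/
def HasClosedTrail (H : Graph α β) (φ : β → Fin 2) (X : Set α) (F : Set β) : Prop :=
  ∃ u a p, IsClosedTrail H φ u a p X F

/-- `X` is the vertex set of a closed alternating trail of `H`, that is, the subgraph induced by `X`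
is supereulerian. -/
def SupereulerianOn (H : Graph α β) (φ : β → Fin 2) (X : Set α) : Prop :=
  ∃ F, HasClosedTrail H φ X F

lemma IsAltWalk.isClosedTrail (h : IsAltWalk H φ u a p u a) (hp : p ≠ [])
    (hn : (p.map Prod.fst).Nodup) :
    IsClosedTrail H φ u a p {w | w ∈ p.map Prod.snd} {e | e ∈ p.map Prod.fst} :=
  ⟨hp, h, hn, fun _ => Iff.rfl, fun _ => Iff.rfl⟩

namespace IsClosedTrail

lemma of_perm (h : IsClosedTrail H φ u a p X F) (hpq : p.Perm q) (hq : IsAltWalk H φ v b q v b) :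
    IsClosedTrail H φ v b q X F where
  ne_nil h0 := h.ne_nil (h0 ▸ hpq).eq_nil
  walk := hq
  nodup := (hpq.map _).nodup_iff.1 h.nodup
  mem_vertices w := (hpq.map Prod.snd).mem_iff.symm.trans (h.mem_vertices w)
  mem_edges e := (hpq.map Prod.fst).mem_iff.symm.trans (h.mem_edges e)

lemma reverse (h : IsClosedTrail H φ u a p X F) :
    IsClosedTrail H φ u (a + 1) (reverseWalk u p) X F where
  ne_nil h0 := h.ne_nil (by simpa [h0] using map_fst_reverseWalk u p)
  walk := h.walk.reverse
  nodup := by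
    rw [map_fst_reverseWalk]
    exact List.nodup_reverse.2 h.nodup
  mem_vertices w := by
    have hperm : (u :: (reverseWalk u p).map Prod.snd).Perm (u :: p.map Prod.snd) := by
      rw [h.walk.support_reverseWalk]
      exact List.reverse_perm _
    rw [← h.mem_vertices, hperm.cons_inv.mem_iff]
  mem_edges e := by rw [← h.mem_edges, map_fst_reverseWalk, List.mem_reverse]

lemma reverse_cons (h : IsClosedTrail H φ u a ((e, v) :: p) X F) :
    IsClosedTrail H φ v a ((e, u) :: reverseWalk v p) X F := by
  refine h.reverse.of_perm (List.perm_append_comm (l₂ := [(e, u)])) ⟨h.walk.1.symm, h.walk.2.1, ?_⟩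
  simpa only [add_one_add_one] using h.walk.2.2.reverse

lemma start_mem (h : IsClosedTrail H φ u a p X F) : u ∈ X :=
  (h.mem_vertices u).1 (h.walk.right_mem_map_snd h.ne_nil)

end IsClosedTrail

namespace HasClosedTrail

lemma exists_isClosedTrail (h : HasClosedTrail H φ X F) (hv : v ∈ X) (b : Fin 2) :
    ∃ q, IsClosedTrail H φ v b q X F := by
  obtain ⟨u, a, p, hp⟩ := h
  obtain ⟨s, t, c, rfl, hs, ht⟩ :=
    hp.walk.exists_append_of_mem_support (List.mem_cons_of_mem _ ((hp.mem_vertices v).2 hv))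
  have hrotate := hp.of_perm List.perm_append_comm (ht.append hs)
  rcases eq_or_eq_add_one b c with rfl | rfl
  · exact ⟨_, hrotate⟩
  · exact ⟨_, hrotate.reverse⟩

lemma exists_isClosedTrail_cons (h : HasClosedTrail H φ X F) (he : e ∈ F) (hl : H.IsLink e x y) :
    ∃ q, IsClosedTrail H φ x (φ e) ((e, y) :: q) X F := by
  obtain ⟨u, a, p, hp⟩ := h
  obtain ⟨⟨e, w⟩, hd, rfl⟩ := List.mem_map.1 ((hp.mem_edges e).2 he)
  obtain ⟨s, t, rfl⟩ := List.append_of_mem hd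
  obtain ⟨v, b, hs, ht⟩ := isAltWalk_append.1 hp.walk
  have hrotate := hp.of_perm List.perm_append_comm (ht.append hs)
  obtain rfl := hrotate.walk.2.1
  obtain ⟨rfl, rfl⟩ | ⟨rfl, rfl⟩ := hl.eq_and_eq_or_eq_and_eq ht.1
  · exact ⟨_, hrotate⟩
  · exact ⟨_, hrotate.reverse_cons⟩

lemma exists_edge (h : HasClosedTrail H φ X F) (hx : x ∈ X) (a : Fin 2) :
    ∃ e ∈ F, φ e = a ∧ ∃ y, H.IsLink e x y := by
  obtain ⟨_ | ⟨⟨e, y⟩, q⟩, hq⟩ := h.exists_isClosedTrail hx a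
  · exact absurd rfl hq.ne_nil
  · exact ⟨e, (hq.mem_edges e).1 List.mem_cons_self, hq.walk.2.1, y, hq.walk.1⟩

lemma nonempty (h : HasClosedTrail H φ X F) : X.Nonempty :=
  let ⟨u, _, _, hp⟩ := h
  ⟨u, hp.start_mem⟩

lemma subset_vertexSet (h : HasClosedTrail H φ X F) : X ⊆ V(H) := fun _ hx =>
  let ⟨_, hq⟩ := h.exists_isClosedTrail hx 0
  hq.walk.left_mem

lemma left_mem_of_isLink (h : HasClosedTrail H φ X F) (he : e ∈ F) (hl : H.IsLink e x y) : x ∈ X :=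
  let ⟨_, hq⟩ := h.exists_isClosedTrail_cons he hl
  hq.start_mem

lemma exists_isLink (h : HasClosedTrail H φ X F) (he : e ∈ F) : ∃ x y, H.IsLink e x y := by
  obtain ⟨u, a, p, hp⟩ := h
  obtain ⟨x, -, y, -, hl⟩ := hp.walk.exists_isLink ((hp.mem_edges e).2 he)
  exact ⟨x, y, hl⟩

lemma notMem_edges (h : HasClosedTrail H φ X F) (hl : H.IsLink e x y) (hx : x ∉ X) : e ∉ F :=
  fun he => hx (h.left_mem_of_isLink he hl)

lemma disjoint_edges (h : HasClosedTrail H φ X F) (h' : HasClosedTrail H φ Y F')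
    (hXY : Disjoint X Y) : Disjoint F F' :=
  Set.disjoint_left.2 fun _ he he' =>
    let ⟨_, _, hl⟩ := h.exists_isLink he
    Set.disjoint_left.1 hXY (h.left_mem_of_isLink he hl) (h'.left_mem_of_isLink he' hl)

lemma union (h : HasClosedTrail H φ X F) (h' : HasClosedTrail H φ Y F') (hF : Disjoint F F')
    (hXY : (X ∩ Y).Nonempty) : HasClosedTrail H φ (X ∪ Y) (F ∪ F') := by
  obtain ⟨v, hX, hY⟩ := hXY
  obtain ⟨p, hp⟩ := h.exists_isClosedTrail hX 0
  obtain ⟨q, hq⟩ := h'.exists_isClosedTrail hY 0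
  refine ⟨v, 0, p ++ q, ?_, hp.walk.append hq.walk, ?_, ?_, ?_⟩
  · exact List.append_ne_nil_of_left_ne_nil hp.ne_nil q
  · rw [List.map_append]
    exact hp.nodup.append hq.nodup fun e he he' =>
      Set.disjoint_left.1 hF ((hp.mem_edges e).1 he) ((hq.mem_edges e).1 he')
  · simp only [List.map_append, List.mem_append, hp.mem_vertices, hq.mem_vertices, Set.mem_union,
      implies_true]
  · simp only [List.map_append, List.mem_append, hp.mem_edges, hq.mem_edges, Set.mem_union,
      implies_true]

/-- The edge `f` of the trail is replaced by the walk `r` between its ends. -/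
lemma supereulerianOn_of_detour (h : HasClosedTrail H φ X F) (hf : f ∈ F) (hl : H.IsLink f x y)
    (hr : IsAltWalk H φ x (φ f) r y (φ f + 1)) (hn : (r.map Prod.fst).Nodup)
    (hrF : ∀ e ∈ r.map Prod.fst, e ∉ F) : SupereulerianOn H φ (X ∪ {w | w ∈ r.map Prod.snd}) := by
  obtain ⟨q, hq⟩ := h.exists_isClosedTrail_cons hf hl
  have hr0 : r ≠ [] := by
    rintro rfl
    exact add_one_ne _ hr.2.2.symm
  have hqF : ∀ e ∈ q.map Prod.fst, e ∈ F := fun e he =>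
    (hq.mem_edges e).1 (List.mem_cons_of_mem _ he)
  have htrail := (hr.append hq.walk.2.2).isClosedTrail (List.append_ne_nil_of_left_ne_nil hr0 q) (by
    rw [List.map_append]
    exact hn.append (List.nodup_cons.1 hq.nodup).2 fun e he he' => hrF e he (hqF e he'))
  have hX : {w | w ∈ (r ++ q).map Prod.snd} = X ∪ {w | w ∈ r.map Prod.snd} := by
    ext w
    have hy : w = y → w ∈ r.map Prod.snd := fun hw => hw ▸ hr.right_mem_map_snd hr0
    simp only [Set.mem_union, ← hq.mem_vertices, List.map_append, List.mem_append, List.map_cons,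
      List.mem_cons, Set.mem_ofPred_eq]
    tauto
  rw [hX] at htrail
  exact ⟨_, _, _, _, htrail⟩

/-- The edge `f` of the trail is replaced by a detour over `g`, along the walk `r` and over `g'`. -/
lemma supereulerianOn_union_of_isAltWalk (h : HasClosedTrail H φ Y F) (hXY : Disjoint X Y)
    (hf : f ∈ F) (hfy : H.IsLink f y y') (hr : IsAltWalk H φ x (φ f + 1) r x' (φ f))
    (hn : (r.map Prod.fst).Nodup) (hrX : ∀ w, w ∈ x :: r.map Prod.snd ↔ w ∈ X) (hxx : x ≠ x')
    (hg : H.IsLink g y x) (hg' : H.IsLink g' x' y') (hgc : φ g = φ f) (hgc' : φ g' = φ f) :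
    SupereulerianOn H φ (X ∪ Y) := by
  have hy : y ∈ Y := h.left_mem_of_isLink hf hfy
  have hy' : y' ∈ Y := h.left_mem_of_isLink hf hfy.symm
  have hdisj : ∀ {z}, z ∈ X → z ∉ Y := fun hz => Set.disjoint_left.1 hXY hz
  have hx : x ∈ X := (hrX x).1 List.mem_cons_self
  have hx' : x' ∈ X := (hrX x').1 hr.right_mem_support
  have hends : ∀ {e v w}, e ∈ r.map Prod.fst → H.IsLink e v w → v ∈ X := fun he hl =>
    (hrX _).1 (hr.left_mem_support_of_isLink he hl)
  have hgg : g ≠ g' := by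
    rintro rfl
    exact (hg.symm.left_eq_or_eq hg').elim hxx fun hxy => hdisj hx (hxy ▸ hy')
  have hwalk : IsAltWalk H φ y (φ f) ((g, x) :: (r ++ [(g', y')])) y' (φ f + 1) :=
    ⟨hg, hgc, hr.concat hg' hgc'⟩
  have hset : Y ∪ {w | w ∈ ((g, x) :: (r ++ [(g', y')])).map Prod.snd} = X ∪ Y := by
    ext w
    have hw : w = y' → w ∈ Y := fun hw => hw ▸ hy'
    simp only [Set.mem_union, ← hrX, List.map_cons, List.map_append, List.map_nil, List.mem_cons,
      List.mem_append, List.not_mem_nil, or_false, Set.mem_ofPred_eq]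
    tauto
  refine hset ▸ h.supereulerianOn_of_detour hf hfy hwalk ?_ fun e he heF => ?_
  · rw [List.map_cons, List.map_append, ← List.cons_append]
    refine (List.nodup_cons.2 ⟨fun hgr => hdisj (hends hgr hg) hy, hn⟩).append
      (List.nodup_singleton g') (List.disjoint_singleton.2 fun hg'r => ?_)
    rcases List.mem_cons.1 hg'r with heq | hg'r
    exacts [hgg heq.symm, hdisj (hends hg'r hg'.symm) hy']
  · simp only [List.map_cons, List.map_append, List.map_nil, List.mem_cons, List.mem_append,
      List.not_mem_nil, or_false] at he
    rcases he with rfl | he | rfl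
    · exact h.notMem_edges hg.symm (hdisj hx) heF
    · obtain ⟨v, w, hl⟩ := h.exists_isLink heF
      exact hdisj (hends he hl) (h.left_mem_of_isLink heF hl)
    · exact h.notMem_edges hg' (hdisj hx') heF

/-- The edges `e = x x'` and `f = y y'` are replaced by `g = x y'` and `g' = y x'`: the first trail
becomes a detour of the second one. -/
lemma supereulerianOn_union_of_exchange (h : HasClosedTrail H φ X F) (h' : HasClosedTrail H φ Y F')
    (hXY : Disjoint X Y) (he : e ∈ F) (hf : f ∈ F') (hxx : x ≠ x') (hex : H.IsLink e x x')
    (hfy : H.IsLink f y y') (hg : H.IsLink g x y') (hg' : H.IsLink g' y x') (hef : φ f = φ e)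
    (hgc : φ g = φ e) (hgc' : φ g' = φ e) : SupereulerianOn H φ (X ∪ Y) := by
  obtain ⟨p, hp⟩ := h.exists_isClosedTrail_cons he hex
  exact h'.supereulerianOn_union_of_isAltWalk hXY hf hfy (hef ▸ hp.walk.2.2)
    (List.nodup_cons.1 hp.nodup).2 hp.mem_vertices hxx.symm hg' hg (hgc'.trans hef.symm)
    (hgc.trans hef.symm)

end HasClosedTrail

lemma SupereulerianOn.nonempty (h : SupereulerianOn H φ X) : X.Nonempty :=
  let ⟨_, hF⟩ := h
  hF.nonempty

end ClosedTrails

section Bridges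

variable {α β : Type*} {H : Graph α β} {φ : β → Fin 2} {u x y : α} {a : Fin 2}
  {p : List (β × α)} {U X Y : Set α} {E : Set β} {S : Set (Set α)}

lemma HasClosedTrail.union_sUnion (h : HasClosedTrail H φ U E) (hfin : S.Finite)
    {F : Set α → Set β} (hF : ∀ X ∈ S, HasClosedTrail H φ X (F X)) (hdisj : S.PairwiseDisjoint id)
    (hE : ∀ X ∈ S, Disjoint E (F X)) (hU : ∀ X ∈ S, (U ∩ X).Nonempty) :
    HasClosedTrail H φ (U ∪ ⋃₀ S) (E ∪ ⋃ X ∈ S, F X) := by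
  induction S, hfin using Set.Finite.induction_on with
  | empty => simpa using h
  | @insert Y S hY _ ih =>
    simp only [Set.forall_mem_insert] at hF hE hU
    obtain ⟨hdisj, hYS⟩ := (Set.pairwiseDisjoint_insert_of_notMem hY).1 hdisj
    have hunion := ih hF.2 hdisj hE.2 hU.2
    rw [Set.sUnion_insert, Set.biUnion_insert, Set.union_left_comm, Set.union_left_comm E,
      Set.union_comm Y, Set.union_comm (F Y)]
    refine hunion.union hF.1 ?_ (hU.1.mono (Set.inter_subset_inter_left _ Set.subset_union_left))
    simp only [Set.disjoint_union_left, Set.disjoint_iUnion_left]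
    exact ⟨hE.1, fun X hX => ((hF.1.disjoint_edges (hF.2 X hX)) (hYS X hX)).symm⟩

/-- The cycle `p` has no edge in common with the trails because none of its edges stays within a
member of `S`. -/
lemma IsAltWalk.supereulerianOn_sUnion (h : IsAltWalk H φ u a p u a) (hp : p ≠ [])
    (hn : (p.map Prod.snd).Nodup) (hfin : S.Finite) (hS : ∀ X ∈ S, SupereulerianOn H φ X)
    (hdisj : S.PairwiseDisjoint id) (hmeet : ∀ X ∈ S, ∃ w ∈ p.map Prod.snd, w ∈ X)
    (hcross : ∀ d ∈ p, ∃ X ∈ S, d.2 ∈ X ∧ ∃ v ∉ X, H.IsLink d.1 v d.2) :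
    SupereulerianOn H φ (⋃₀ S) := by
  choose! F hF using hS
  have hcycle : HasClosedTrail H φ _ _ := ⟨_, _, _, h.isClosedTrail hp (h.nodup_edges_of_cycle hn)⟩
  have hunion := hcycle.union_sUnion hfin hF hdisj ?_ hmeet
  · have hsub : {w | w ∈ p.map Prod.snd} ⊆ ⋃₀ S := by
      intro w hw
      obtain ⟨d, hd, rfl⟩ := List.mem_map.1 hw
      obtain ⟨X, hX, hdX, -⟩ := hcross d hd
      exact ⟨X, hX, hdX⟩
    rw [Set.union_eq_self_of_subset_left hsub] at hunion
    exact ⟨_, hunion⟩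
  · refine fun Y hY => Set.disjoint_left.2 fun e he heY => ?_
    obtain ⟨d, hd, rfl⟩ := List.mem_map.1 he
    obtain ⟨X, hX, hdX, v, hv, hl⟩ := hcross d hd
    obtain rfl : Y = X := hdisj.elim_set hY hX _ ((hF Y hY).left_mem_of_isLink heY hl.symm) hdX
    exact hv ((hF Y hY).left_mem_of_isLink heY hl)

lemma IsAltWalk.supereulerianOn_union (h : IsAltWalk H φ u a p u a) (hn : (p.map Prod.snd).Nodup)
    (hX : SupereulerianOn H φ X) (hY : SupereulerianOn H φ Y) (hXY : Disjoint X Y)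
    (hxX : x ∈ X) (hx : x ∈ p.map Prod.snd) (hyY : y ∈ Y) (hy : y ∈ p.map Prod.snd)
    (hcross : ∀ d ∈ p, ∃ v, H.IsLink d.1 v d.2 ∧ (d.2 ∈ X ∧ v ∈ Y ∨ d.2 ∈ Y ∧ v ∈ X)) :
    SupereulerianOn H φ (X ∪ Y) := by
  have hp : p ≠ [] := by
    rintro rfl
    exact List.not_mem_nil hx
  rw [← Set.sUnion_pair]
  refine h.supereulerianOn_sUnion hp hn (Set.toFinite _) ?_ ?_ ?_ ?_
  · rintro _ (rfl | rfl)
    exacts [hX, hY]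
  · exact Set.pairwise_pair.2 fun _ => ⟨hXY, hXY.symm⟩
  · rintro _ (rfl | rfl)
    exacts [⟨x, hx, hxX⟩, ⟨y, hy, hyY⟩]
  · intro d hd
    obtain ⟨v, hl, ⟨hdX, hv⟩ | ⟨hdY, hv⟩⟩ := hcross d hd
    · exact ⟨X, by simp, hdX, v, Set.disjoint_right.1 hXY hv, hl⟩
    · exact ⟨Y, by simp, hdY, v, Set.disjoint_left.1 hXY hv, hl⟩

end Bridges

section Traversals

variable {α β : Type*} {H : Graph α β} {φ : β → Fin 2} {u v : α} {a b : Fin 2} {p : List (β × α)}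
  {X : Set α} {F : Set β} {N : ℤ} {x : ℤ → α} {ε : ℤ → β}

lemma exists_periodic_of_isChain_append_self {δ : Type*} {r : δ → δ → Prop} {l : List δ}
    (hl : l ≠ []) (h : (l ++ l).IsChain r) :
    ∃ g : ℤ → δ, Function.Periodic g l.length ∧ (∀ i, r (g i) (g (i + 1))) ∧
      Set.range g = {d | d ∈ l} := by
  have hpos : 0 < l.length := List.length_pos_iff.2 hl
  have hlt (i : ℤ) : (i % l.length).toNat < l.length := by
    have := Int.emod_lt_of_pos i (Int.natCast_pos.2 hpos)
    omega
  refine ⟨fun i => l[(i % l.length).toNat]'(hlt i), fun i => ?_, fun i => ?_, ?_⟩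
  · simp only [Int.add_emod_right]
  · generalize hk : (i % l.length).toNat = k
    have hkl : k < l.length := hk ▸ hlt i
    have hi : i % l.length = k := by
      have := Int.emod_nonneg i (Int.natCast_pos.2 hpos).ne'
      omega
    have hr := List.isChain_iff_getElem.1 h k (by rw [List.length_append]; omega)
    rw [List.getElem_append_left hkl] at hr
    have hsucc : ((i + 1) % l.length).toNat = (k + 1) % l.length := by
      rw [← Int.emod_add_emod, hi]
      norm_cast
    simp only [hsucc, hk]
    rcases Nat.lt_or_eq_of_le hkl with hlast | hlast
    · rw [List.getElem_append_left hlast] at hr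
      simpa only [Nat.mod_eq_of_lt hlast] using hr
    · rw [List.getElem_append_right hlast.ge] at hr
      simpa [← hlast] using hr
  · ext d
    refine ⟨?_, fun hd => ?_⟩
    · rintro ⟨i, rfl⟩
      exact List.getElem_mem _
    · obtain ⟨k, hk, rfl⟩ := List.mem_iff_getElem.1 hd
      refine ⟨k, ?_⟩
      simp only [← Int.natCast_mod, Int.toNat_natCast, Nat.mod_eq_of_lt hk]

lemma IsAltWalk.isChain (h : IsAltWalk H φ u a p v b) :
    p.IsChain fun d d' => H.IsLink d'.1 d.2 d'.2 ∧ φ d'.1 = φ d.1 + 1 := by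
  induction p generalizing u a with
  | nil => exact List.isChain_nil
  | cons d p ih =>
    refine List.isChain_cons.2 ⟨fun d' hd' => ?_, ih h.2.2⟩
    obtain ⟨p, rfl⟩ : ∃ q, p = d' :: q := ⟨_, List.eq_cons_of_mem_head? hd'⟩
    obtain ⟨-, rfl, hl, hc, -⟩ := h
    exact ⟨hl, hc⟩

/-- A closed alternating trail with vertex set `X` and edge set `F`, written as bi-infinite
sequences of period `N`: the edge `ε i` joins the vertices `x i` and `x (i + 1)`. -/
structure IsTraversal (H : Graph α β) (φ : β → Fin 2) (N : ℤ) (x : ℤ → α) (ε : ℤ → β)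
    (X : Set α) (F : Set β) : Prop where
  pos : 0 < N
  periodic_vertex : Function.Periodic x N
  periodic_edge : Function.Periodic ε N
  isLink : ∀ i, H.IsLink (ε i) (x i) (x (i + 1))
  color_add_one : ∀ i, φ (ε (i + 1)) = φ (ε i) + 1
  range_vertex : Set.range x = X
  range_edge : Set.range ε = F

lemma HasClosedTrail.exists_isTraversal (h : HasClosedTrail H φ X F) :
    ∃ N x ε, IsTraversal H φ N x ε X F := by
  obtain ⟨u, a, p, hp⟩ := h
  obtain ⟨g, hper, hchain, hrange⟩ :=
    exists_periodic_of_isChain_append_self hp.ne_nil (hp.walk.append hp.walk).isChain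
  refine ⟨p.length, fun i => (g i).2, fun i => (g (i + 1)).1, ?_, fun i => ?_, fun i => ?_,
    fun i => (hchain i).1, fun i => (hchain (i + 1)).2, ?_, ?_⟩
  · exact Int.natCast_pos.2 (List.length_pos_iff.2 hp.ne_nil)
  · simp only [hper i]
  · simp only [add_right_comm i _ 1, hper (i + 1)]
  · ext w
    rw [← hp.mem_vertices, List.mem_map]
    change w ∈ Set.range (Prod.snd ∘ g) ↔ ∃ d ∈ {d | d ∈ p}, _
    rw [Set.range_comp, hrange, Set.mem_image]
  · ext e
    rw [← hp.mem_edges, List.mem_map]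
    change e ∈ Set.range (Prod.fst ∘ g ∘ Equiv.addRight (1 : ℤ)) ↔ ∃ d ∈ {d | d ∈ p}, _
    rw [Set.range_comp, EquivLike.range_comp, hrange, Set.mem_image]

end Traversals

section Domination

variable {α β γ : Type*} {H : Graph α β} {φ : β → Fin 2} {κ : α → γ} {x x' y y' : α}
  {e f : β} {X Y : Set α} {F F' : Set β} {col : α → α → Fin 2} {c : α → Fin 2}

lemma supereulerianOn_union_of_parallel (hX : SupereulerianOn H φ X) (hY : SupereulerianOn H φ Y)
    (hXY : Disjoint X Y) (hx : x ∈ X) (hy : y ∈ Y) (he : H.IsLink e x y) (hf : H.IsLink f x y)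
    (hef : φ e ≠ φ f) : SupereulerianOn H φ (X ∪ Y) := by
  have hcycle : IsAltWalk H φ x (φ e) [(e, y), (f, x)] x (φ e) :=
    ⟨he, rfl, hf.symm, ne_iff_eq_add_one.1 hef.symm, he.left_mem, rfl, add_one_add_one _⟩
  have hne : x ≠ y := hXY.ne_of_mem hx hy
  refine hcycle.supereulerianOn_union (by simpa using hne.symm) hX hY hXY hx (by simp) hy (by simp)
    ?_
  simp only [List.forall_mem_cons]
  exact ⟨⟨x, he, .inr ⟨hy, hx⟩⟩, ⟨y, hf.symm, .inl ⟨hx, hy⟩⟩, by simp⟩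

lemma IsExtendedComplete.supereulerianOn_union_of_class_eq (hH : IsExtendedComplete H φ κ)
    (h : HasClosedTrail H φ X F) (h' : HasClosedTrail H φ Y F') (hXY : Disjoint X Y) (hx : x ∈ X)
    (hy : y ∈ Y) (hκ : κ x = κ y) : SupereulerianOn H φ (X ∪ Y) := by
  obtain ⟨e, he, hec, x', hex⟩ := h.exists_edge hx 0
  obtain ⟨f, hf, hfc, y', hfy⟩ := h'.exists_edge hy 0
  obtain ⟨g, hg, hgc⟩ := hH.twin hfy hex.left_mem hκ
  obtain ⟨g', hg', hgc'⟩ := hH.twin hex hfy.left_mem hκ.symm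
  exact h.supereulerianOn_union_of_exchange h' hXY he hf (hH.vertex_ne hex) hex hfy hg hg'
    (hfc.trans hec.symm) (hgc.trans (hfc.trans hec.symm)) hgc'

/-- `X` and `Y` are completely joined, and every edge between `x ∈ X` and `y ∈ Y` has the colour
`col x y`. -/
def IsCrossColouring (H : Graph α β) (φ : β → Fin 2) (X Y : Set α) (col : α → α → Fin 2) : Prop :=
  ∀ x ∈ X, ∀ y ∈ Y, H.Adj x y ∧ ∀ e, H.IsLink e x y → φ e = col x y

lemma IsCrossColouring.swap (h : IsCrossColouring H φ X Y col) :
    IsCrossColouring H φ Y X fun y x => col x y := fun y hy x hx =>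
  ⟨(h x hx y hy).1.symm, fun e he => (h x hx y hy).2 e he.symm⟩

lemma IsCrossColouring.exists_isLink (h : IsCrossColouring H φ X Y col) (hx : x ∈ X) (hy : y ∈ Y) :
    ∃ e, H.IsLink e x y ∧ φ e = col x y :=
  let ⟨e, he⟩ := (h x hx y hy).1
  ⟨e, he, (h x hx y hy).2 e he⟩

lemma IsExtendedComplete.exists_isCrossColouring (hH : IsExtendedComplete H φ κ)
    (h : HasClosedTrail H φ X F) (h' : HasClosedTrail H φ Y F') (hXY : Disjoint X Y)
    (hno : ¬ SupereulerianOn H φ (X ∪ Y)) : ∃ col, IsCrossColouring H φ X Y col := by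
  have hadj : ∀ x ∈ X, ∀ y ∈ Y, H.Adj x y := fun x hx y hy =>
    hH.adj (h.subset_vertexSet hx) (h'.subset_vertexSet hy) fun hκ =>
      hno (hH.supereulerianOn_union_of_class_eq h h' hXY hx hy hκ)
  have hcol : ∀ x ∈ X, ∀ y ∈ Y, ∃ s, ∀ e, H.IsLink e x y → φ e = s := fun x hx y hy => by
    obtain ⟨f, hf⟩ := hadj x hx y hy
    refine ⟨φ f, fun e he => ?_⟩
    by_contra hne
    exact hno (supereulerianOn_union_of_parallel ⟨F, h⟩ ⟨F', h'⟩ hXY hx hy he hf hne)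
  choose! col hcol using hcol
  exact ⟨col, fun x hx y hy => ⟨hadj x hx y hy, hcol x hx y hy⟩⟩

lemma IsCrossColouring.supereulerianOn_union (hcol : IsCrossColouring H φ X Y col)
    (hX : SupereulerianOn H φ X) (hY : SupereulerianOn H φ Y) (hXY : Disjoint X Y) (hx : x ∈ X)
    (hx' : x' ∈ X) (hy : y ∈ Y) (hy' : y' ∈ Y) (h₁ : col x y ≠ col x' y)
    (h₂ : col x' y ≠ col x' y') (h₃ : col x' y' ≠ col x y') :
    SupereulerianOn H φ (X ∪ Y) := by
  obtain ⟨e₁, l₁, k₁⟩ := hcol.exists_isLink hx hy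
  obtain ⟨e₂, l₂, k₂⟩ := hcol.exists_isLink hx' hy
  obtain ⟨e₃, l₃, k₃⟩ := hcol.exists_isLink hx' hy'
  obtain ⟨e₄, l₄, k₄⟩ := hcol.exists_isLink hx hy'
  have c₂ := ne_iff_eq_add_one.1 h₁.symm
  have c₃ := ne_iff_eq_add_one.1 h₂.symm
  have c₄ := ne_iff_eq_add_one.1 h₃.symm
  rw [c₂, add_one_add_one] at c₃
  rw [c₃] at c₄
  have hcycle : IsAltWalk H φ x (col x y) [(e₁, y), (e₂, x'), (e₃, y'), (e₄, x)] x (col x y) := by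
    simp only [IsAltWalk, add_one_add_one]
    exact ⟨l₁, k₁, l₂.symm, k₂.trans c₂, l₃, k₃.trans c₃, l₄.symm, k₄.trans c₄, l₁.left_mem,
      trivial, trivial⟩
  have hxx : x' ≠ x := fun h => h₁ (by rw [h])
  have hyy : y ≠ y' := fun h => h₂ (by rw [h])
  refine hcycle.supereulerianOn_union ?_ hX hY hXY hx (by simp) hy (by simp) ?_
  · simp [hxx, hyy, hXY.ne_of_mem hx' hy', (hXY.ne_of_mem hx hy).symm, (hXY.ne_of_mem hx hy').symm,
      (hXY.ne_of_mem hx' hy).symm]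
  · simp only [List.forall_mem_cons]
    exact ⟨⟨x, l₁, .inr ⟨hy, hx⟩⟩, ⟨y, l₂.symm, .inl ⟨hx', hy⟩⟩, ⟨x', l₃, .inr ⟨hy', hx'⟩⟩,
      ⟨y', l₄.symm, .inl ⟨hx, hy'⟩⟩, by simp⟩

namespace IsTraversal

variable {M N : ℤ} {x y : ℤ → α} {ε η : ℤ → β}

lemma mem_vertices (h : IsTraversal H φ N x ε X F) (i : ℤ) : x i ∈ X := h.range_vertex ▸ ⟨i, rfl⟩

lemma mem_edges (h : IsTraversal H φ N x ε X F) (i : ℤ) : ε i ∈ F := h.range_edge ▸ ⟨i, rfl⟩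

lemma isUnmergeable (hx : IsTraversal H φ M x ε X F) (hy : IsTraversal H φ N y η Y F')
    (h : HasClosedTrail H φ X F) (h' : HasClosedTrail H φ Y F') (hXY : Disjoint X Y)
    (hne : ∀ i, x i ≠ x (i + 1)) (hno : ¬ SupereulerianOn H φ (X ∪ Y))
    (hcol : IsCrossColouring H φ X Y col) :
    IsUnmergeable (fun i j => col (x i) (y j)) (fun i => φ (ε i)) (fun j => φ (η j)) (M * N) where
  pos := mul_pos hx.pos hy.pos
  periodic_left j i := by
    rw [mul_comm]
    exact congrArg (col · (y j)) (hx.periodic_vertex.int_mul N i)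
  periodic_right i j := congrArg (col (x i)) (hy.periodic_vertex.int_mul M j)
  periodic_color_left i := by
    rw [mul_comm]
    exact congrArg φ (hx.periodic_edge.int_mul N i)
  color_left_add_one := hx.color_add_one
  color_right_add_one := hy.color_add_one
  parallel {i j} hij hc hc' := by
    obtain ⟨g, hg, hgc⟩ := hcol.exists_isLink (hx.mem_vertices i) (hy.mem_vertices j)
    obtain ⟨g', hg', hgc'⟩ := hcol.exists_isLink (hx.mem_vertices (i + 1)) (hy.mem_vertices (j + 1))
    exact hno (h.supereulerianOn_union_of_exchange h' hXY (hx.mem_edges i) (hy.mem_edges j) (hne i)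
      (hx.isLink i) (hy.isLink j).symm hg hg'.symm hij.symm (hgc.trans hc) (hgc'.trans hc'))
  crossing {i j} hij hc hc' := by
    obtain ⟨g, hg, hgc⟩ := hcol.exists_isLink (hx.mem_vertices i) (hy.mem_vertices (j + 1))
    obtain ⟨g', hg', hgc'⟩ := hcol.exists_isLink (hx.mem_vertices (i + 1)) (hy.mem_vertices j)
    exact hno (h.supereulerianOn_union_of_exchange h' hXY (hx.mem_edges i) (hy.mem_edges j) (hne i)
      (hx.isLink i) (hy.isLink j) hg hg'.symm hij.symm (hgc.trans hc) (hgc'.trans hc'))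
  nested {i i' j j'} h₁ h₂ := by
    by_contra h₃
    exact hno (hcol.supereulerianOn_union ⟨F, h⟩ ⟨F', h'⟩ hXY (hx.mem_vertices i)
      (hx.mem_vertices i') (hy.mem_vertices j) (hy.mem_vertices j') h₁ h₂ h₃)

end IsTraversal

/-- All edges between `x ∈ X` and `Y` have the colour `c x`, where `c` alternates along the edges in
`F`. It is used for the vertex set `X` and the edge set `F` of a closed alternating trail. -/
structure Dominates (H : Graph α β) (φ : β → Fin 2) (X : Set α) (F : Set β) (Y : Set α)
    (c : α → Fin 2) : Prop where
  isCrossColouring : IsCrossColouring H φ X Y fun x _ => c x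
  alternates : ∀ {e x x'}, e ∈ F → H.IsLink e x x' → c x' = c x + 1

lemma IsTraversal.exists_dominates {N : ℤ} {x : ℤ → α} {ε : ℤ → β} {a : Fin 2}
    (h : IsTraversal H φ N x ε X F) (hcol : IsCrossColouring H φ X Y col) (hY : Y.Nonempty)
    (ha : ∀ i, ∀ y ∈ Y, col (x i) y = φ (ε i) + a) : ∃ c, Dominates H φ X F Y c := by
  obtain ⟨y₀, hy₀⟩ := hY
  refine ⟨fun x => col x y₀, fun w hw y hy => ?_, fun {e w w'} he hl => ?_⟩
  · have hconst : col w y = col w y₀ := by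
      obtain ⟨i, rfl⟩ := h.range_vertex.symm ▸ hw
      rw [ha i y hy, ha i y₀ hy₀]
    exact ⟨(hcol w hw y hy).1, fun e he => ((hcol w hw y hy).2 e he).trans hconst⟩
  · obtain ⟨i, rfl⟩ := h.range_edge.symm ▸ he
    have hstep : col (x (i + 1)) y₀ = col (x i) y₀ + 1 := by
      rw [ha _ y₀ hy₀, ha _ y₀ hy₀, h.color_add_one, add_right_comm]
    obtain ⟨rfl, rfl⟩ | ⟨rfl, rfl⟩ := hl.eq_and_eq_or_eq_and_eq (h.isLink i)
    · exact hstep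
    · exact (add_one_add_one _).symm.trans (congrArg (· + 1) hstep.symm)

theorem IsExtendedComplete.dominates_or_dominates (hH : IsExtendedComplete H φ κ)
    (h : HasClosedTrail H φ X F) (h' : HasClosedTrail H φ Y F') (hXY : Disjoint X Y)
    (hno : ¬ SupereulerianOn H φ (X ∪ Y)) :
    (∃ c, Dominates H φ X F Y c) ∨ ∃ c, Dominates H φ Y F' X c := by
  obtain ⟨col, hcol⟩ := hH.exists_isCrossColouring h h' hXY hno
  obtain ⟨M, x, ε, hx⟩ := h.exists_isTraversal
  obtain ⟨N, y, η, hy⟩ := h'.exists_isTraversal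
  have hunmergeable := hx.isUnmergeable hy h h' hXY (fun i => hH.vertex_ne (hx.isLink i)) hno hcol
  refine hunmergeable.eq_left_or_eq_right.imp ?_ ?_
  · rintro ⟨a, ha⟩
    refine hx.exists_dominates hcol h'.nonempty (a := a) fun i w hw => ?_
    obtain ⟨j, rfl⟩ := hy.range_vertex.symm ▸ hw
    exact ha i j
  · rintro ⟨a, ha⟩
    refine hy.exists_dominates hcol.swap h.nonempty (a := a) fun j w hw => ?_
    obtain ⟨i, rfl⟩ := hx.range_vertex.symm ▸ hw
    exact ha i j

end Domination

section Factors

lemma exists_forall_of_no_cyclic_triple {δ : Type*} {r : δ → δ → Prop} {s : Set δ} (hfin : s.Finite)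
    (hs : s.Nonempty) (htotal : s.Pairwise fun x y => r x y ∨ r y x)
    (hcyclic : ∀ x ∈ s, ∀ y ∈ s, ∀ z ∈ s, x ≠ y → y ≠ z → z ≠ x → r x y → r y z → ¬ r z x) :
    ∃ m ∈ s, ∀ x ∈ s, x ≠ m → r m x := by
  induction s, hfin using Set.Finite.induction_on with
  | empty => exact absurd hs Set.not_nonempty_empty
  | @insert y s hy _ ih =>
    rcases s.eq_empty_or_nonempty with rfl | hs
    · exact ⟨y, by simp⟩
    obtain ⟨m, hm, hmax⟩ := ih hs (htotal.mono (Set.subset_insert y s))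
      fun x hx y hy z hz => hcyclic x (.inr hx) y (.inr hy) z (.inr hz)
    have hym : y ≠ m := fun h => hy (h ▸ hm)
    rcases htotal (.inr hm) (.inl rfl) hym.symm with hmy | hmy
    · refine ⟨m, .inr hm, ?_⟩
      rintro x (rfl | hx) hxm
      exacts [hmy, hmax x hx hxm]
    · refine ⟨y, .inl rfl, ?_⟩
      rintro x (rfl | hx) hxy
      · exact absurd rfl hxy
      · rcases eq_or_ne x m with rfl | hxm
        · exact hmy
        · exact (htotal (.inl rfl) (.inr hx) hxy.symm).resolve_right
            (hcyclic y (.inl rfl) m (.inr hm) x (.inr hx) hym hxm.symm hxy hmy (hmax x hx hxm))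

variable {α β γ : Type*} {H : Graph α β} {φ : β → Fin 2} {κ : α → γ} {u v x x' : α} {a b : Fin 2}
  {e : β} {p : List (β × α)} {X Y Z : Set α} {E F F' : Set β} {c c' c'' : α → Fin 2}
  {P S : Set (Set α)}

lemma Dominates.exists_color_eq (h : Dominates H φ X F Y c) (hX : HasClosedTrail H φ X F)
    (a : Fin 2) : ∃ x ∈ X, c x = a := by
  obtain ⟨x, hx⟩ := hX.nonempty
  obtain ⟨e, he, -, x', hl⟩ := hX.exists_edge hx 0
  rcases eq_or_eq_add_one a (c x) with rfl | rfl
  · exact ⟨x, hx, rfl⟩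
  · exact ⟨x', hX.left_mem_of_isLink he hl.symm, h.alternates he hl⟩

lemma Dominates.mono (h : Dominates H φ X F Y c) (hZ : Z ⊆ Y) : Dominates H φ X F Z c :=
  ⟨fun x hx z hz => h.isCrossColouring x hx z (hZ hz), h.alternates⟩

/-- An edge of the trail on `Y` is replaced by a detour to `x`, along the whole trail on `X` back to
`x`, and then over `e` to `x'`. -/
lemma Dominates.supereulerianOn_union_of_chord (h : Dominates H φ X F Y c)
    (hX : HasClosedTrail H φ X F) (hY : HasClosedTrail H φ Y F') (hXY : Disjoint X Y) (hx : x ∈ X)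
    (hx' : x' ∈ X) (hxx : x ≠ x') (hl : H.IsLink e x x') (hc : c x' = c x) (he : φ e = c x + 1) :
    SupereulerianOn H φ (X ∪ Y) := by
  obtain ⟨y, hy⟩ := hY.nonempty
  obtain ⟨f, hf, hfc, y', hfl⟩ := hY.exists_edge hy (c x)
  obtain ⟨p, hp⟩ := hX.exists_isClosedTrail hx (c x + 1)
  obtain ⟨g, hg, hgc⟩ := h.isCrossColouring.exists_isLink hx hy
  obtain ⟨g', hg', hgc'⟩ :=
    h.isCrossColouring.exists_isLink hx' (hY.left_mem_of_isLink hf hfl.symm)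
  have heF : e ∉ F := fun heF => add_one_ne _ ((h.alternates heF hl).symm.trans hc)
  have hwalk := hp.walk.concat hl he
  rw [add_one_add_one, ← hfc] at hwalk
  refine hY.supereulerianOn_union_of_isAltWalk hXY hf hfl hwalk ?_ (fun w => ?_) hxx hg.symm hg'
    (hgc.trans hfc.symm) ((hgc'.trans hc).trans hfc.symm)
  · rw [List.map_append]
    exact hp.nodup.append (List.nodup_singleton e)
      (List.disjoint_singleton.2 fun hep => heF ((hp.mem_edges e).1 hep))
  · have hwx : w = x → w ∈ X := fun hw => hw ▸ hx
    have hwx' : w = x' → w ∈ X := fun hw => hw ▸ hx'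
    simp only [List.map_append, List.map_cons, List.map_nil, List.mem_cons, List.mem_append,
      List.not_mem_nil, or_false, hp.mem_vertices]
    tauto

lemma Dominates.exists_chord (h : Dominates H φ X F (V(H) \ X) c) (hp : IsAltWalk H φ u a p v b)
    (hu : u ∈ X → a = c u + 1) (hv : v ∈ X) (hb : b = c v) :
    ∃ x ∈ X, ∃ x' ∈ X, ∃ e, H.IsLink e x x' ∧ c x' = c x ∧ φ e = c x + 1 := by
  induction p generalizing u a with
  | nil =>
    obtain ⟨_, rfl, rfl⟩ := hp
    exact absurd ((hu hv).symm.trans hb) (add_one_ne _)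
  | cons d p ih =>
    obtain ⟨hl, rfl, hp⟩ := hp
    by_cases hd : d.2 ∈ X
    · by_cases huX : u ∈ X
      · rcases eq_or_eq_add_one (c d.2) (c u) with hc | hc
        · exact ⟨u, huX, d.2, hd, d.1, hl, hc, hu huX⟩
        · exact ih hp fun _ => by rw [hc, hu huX]
      · refine ih hp fun _ => congrArg (· + 1) ?_
        exact (h.isCrossColouring _ hd u ⟨hl.left_mem, huX⟩).2 _ hl.symm
    · exact ih hp fun hd' => absurd hd' hd

/-- An eulerian factor, given as the family of the vertex sets of its closed alternating trails. -/
structure IsEulerianFactor (H : Graph α β) (φ : β → Fin 2) (P : Set (Set α)) : Prop where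
  finite : P.Finite
  pairwiseDisjoint : P.PairwiseDisjoint id
  sUnion_eq : ⋃₀ P = V(H)
  supereulerianOn : ∀ X ∈ P, SupereulerianOn H φ X

/-- An eulerian factor no two or more members of which can be merged into one closed alternating
trail. -/
structure IsIrreducibleFactor (H : Graph α β) (φ : β → Fin 2) (P : Set (Set α)) : Prop extends
    IsEulerianFactor H φ P where
  irreducible : ∀ S ⊆ P, S.Nontrivial → ¬ SupereulerianOn H φ (⋃₀ S)

lemma IsEulerianFactor.merge (hP : IsEulerianFactor H φ P) (hSP : S ⊆ P)
    (hS : SupereulerianOn H φ (⋃₀ S)) : IsEulerianFactor H φ (insert (⋃₀ S) (P \ S)) where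
  finite := hP.finite.sdiff.insert _
  pairwiseDisjoint := by
    refine (hP.pairwiseDisjoint.subset Set.sdiff_subset).insert fun X hX _ =>
      Set.disjoint_sUnion_left.2 fun Y hY => ?_
    exact hP.pairwiseDisjoint (hSP hY) hX.1 fun hYX => hX.2 (hYX ▸ hY)
  sUnion_eq := by
    rw [Set.sUnion_insert, ← Set.sUnion_union, Set.union_sdiff_cancel hSP, hP.sUnion_eq]
  supereulerianOn := by
    rintro X (rfl | hX)
    exacts [hS, hP.supereulerianOn X hX.1]

lemma IsEulerianFactor.exists_isIrreducibleFactor (hP : IsEulerianFactor H φ P) :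
    ∃ Q, IsIrreducibleFactor H φ Q := by
  obtain ⟨Q, hQ, hmin⟩ :=
    exists_minimalFor_of_wellFoundedLT (IsEulerianFactor H φ) Set.ncard ⟨P, hP⟩
  refine ⟨Q, hQ, fun S hSQ hS hmerge => ?_⟩
  have hinsert := Set.ncard_insert_le (⋃₀ S) (Q \ S)
  have hdiff := Set.ncard_sdiff_add_ncard_of_subset hSQ hQ.finite
  have hSfin := hQ.finite.subset hSQ
  have hone := (Set.one_lt_ncard hSfin).2 hS
  have hle := hmin (hQ.merge hSQ hmerge) (by omega)
  omega

namespace IsIrreducibleFactor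

lemma not_supereulerianOn_union (hP : IsIrreducibleFactor H φ P) (hX : X ∈ P) (hY : Y ∈ P)
    (hXY : X ≠ Y) : ¬ SupereulerianOn H φ (X ∪ Y) := by
  rw [← Set.sUnion_pair]
  exact hP.irreducible _ (Set.pair_subset hX hY) (Set.nontrivial_pair hXY)

/-- Otherwise the members that are visited by the cycle would be merged. -/
lemma not_isAltWalk (hP : IsIrreducibleFactor H φ P) (hp : p ≠ []) (hn : (p.map Prod.snd).Nodup)
    (hcross : ∀ d ∈ p, ∃ X ∈ P, d.2 ∈ X ∧ ∃ v ∉ X, H.IsLink d.1 v d.2) :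
    ¬ IsAltWalk H φ u a p u a := by
  intro h
  let S := {X ∈ P | ∃ w ∈ p.map Prod.snd, w ∈ X}
  have hSP : S ⊆ P := fun X hX => hX.1
  refine hP.irreducible S hSP ?_ (h.supereulerianOn_sUnion hp hn (hP.finite.subset hSP)
    (fun X hX => hP.supereulerianOn X hX.1) (hP.pairwiseDisjoint.subset hSP) (fun X hX => hX.2) ?_)
  · obtain ⟨d, q, rfl⟩ := List.exists_cons_of_ne_nil hp
    obtain ⟨X, hX, hdX, v, hv, hl⟩ := hcross d List.mem_cons_self
    obtain ⟨d', hd', hdu⟩ := List.mem_map.1 (h.right_mem_map_snd hp)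
    obtain ⟨Y, hY, huY, -⟩ := hcross d' hd'
    refine ⟨X, ⟨hX, d.2, List.mem_cons_self, hdX⟩, Y, ⟨hY, d'.2, List.mem_map_of_mem hd', huY⟩, ?_⟩
    rintro rfl
    rcases hl.left_eq_or_eq h.1 with rfl | rfl
    · exact hv (hdu ▸ huY)
    · exact hv hdX
  · intro d hd
    obtain ⟨X, hX, hdX, hv⟩ := hcross d hd
    exact ⟨X, ⟨hX, d.2, List.mem_map_of_mem hd, hdX⟩, hdX, hv⟩

lemma notMem (hP : IsIrreducibleFactor H φ P) (hX : X ∈ P) (hY : Y ∈ P) (hXY : X ≠ Y)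
    (hx : x ∈ X) : x ∉ Y :=
  Set.disjoint_left.1 (hP.pairwiseDisjoint hX hY hXY) hx

lemma ne_of_mem (hP : IsIrreducibleFactor H φ P) (hX : X ∈ P) (hY : Y ∈ P) (hXY : X ≠ Y)
    (hx : x ∈ X) (hx' : x' ∈ Y) : x ≠ x' :=
  (hP.pairwiseDisjoint hX hY hXY).ne_of_mem hx hx'

lemma color_eq_of_dominates (hP : IsIrreducibleFactor H φ P) (hX : X ∈ P) (hY : Y ∈ P) (hZ : Z ∈ P)
    (hXY : X ≠ Y) (hXZ : X ≠ Z) (hF : HasClosedTrail H φ X F) (h : Dominates H φ X F Y c)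
    (h' : Dominates H φ X F Z c') (hx : x ∈ X) : c' x = c x := by
  by_contra hne
  obtain ⟨y, hy⟩ := (hP.supereulerianOn Y hY).nonempty
  obtain ⟨z, hz⟩ := (hP.supereulerianOn Z hZ).nonempty
  obtain ⟨e, he, -, x', hl⟩ := hF.exists_edge hx 0
  have hx' : x' ∈ X := hF.left_mem_of_isLink he hl.symm
  have hcx : c' x = c x + 1 := ne_iff_eq_add_one.1 hne
  have hc : c x' = c x + 1 := h.alternates he hl
  have hc' : c' x' = c x := (h'.alternates he hl).trans (by rw [hcx, add_one_add_one])
  obtain ⟨e₁, l₁, k₁⟩ := h.isCrossColouring.exists_isLink hx hy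
  obtain ⟨e₂, l₂, k₂⟩ := h.isCrossColouring.exists_isLink hx' hy
  obtain ⟨e₃, l₃, k₃⟩ := h'.isCrossColouring.exists_isLink hx' hz
  obtain ⟨e₄, l₄, k₄⟩ := h'.isCrossColouring.exists_isLink hx hz
  have hYZ : Y ≠ Z := by
    rintro rfl
    exact hne (((h'.isCrossColouring x hx y hy).2 e₁ l₁).symm.trans k₁)
  have hcycle : IsAltWalk H φ x (c x) [(e₁, y), (e₂, x'), (e₃, z), (e₄, x)] x (c x) := by
    simp only [IsAltWalk, add_one_add_one]
    exact ⟨l₁, k₁, l₂.symm, k₂.trans hc, l₃, k₃.trans hc', l₄.symm, k₄.trans hcx, l₁.left_mem,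
      trivial, trivial⟩
  have hxx : x' ≠ x := fun hxx => add_one_ne _ (hc.symm.trans (congrArg c hxx))
  refine hP.not_isAltWalk (List.cons_ne_nil _ _) ?_ ?_ hcycle
  · simp [hxx, hP.ne_of_mem hY hZ hYZ hy hz, hP.ne_of_mem hX hZ hXZ hx' hz,
      hP.ne_of_mem hY hX hXY.symm hy hx, hP.ne_of_mem hY hX hXY.symm hy hx',
      hP.ne_of_mem hZ hX hXZ.symm hz hx]
  · simp only [List.forall_mem_cons]
    exact ⟨⟨Y, hY, hy, x, hP.notMem hX hY hXY hx, l₁⟩,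
      ⟨X, hX, hx', y, hP.notMem hY hX hXY.symm hy, l₂.symm⟩,
      ⟨Z, hZ, hz, x', hP.notMem hX hZ hXZ hx', l₃⟩,
      ⟨X, hX, hx, z, hP.notMem hZ hX hXZ.symm hz, l₄.symm⟩, by simp⟩

lemma not_dominates_of_dominates_of_dominates (hP : IsIrreducibleFactor H φ P) (hX : X ∈ P)
    (hY : Y ∈ P) (hZ : Z ∈ P) (hXY : X ≠ Y) (hYZ : Y ≠ Z) (hZX : Z ≠ X)
    (hE : HasClosedTrail H φ X E) (hF : HasClosedTrail H φ Y F) (hF' : HasClosedTrail H φ Z F')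
    (h : Dominates H φ X E Y c) (h' : Dominates H φ Y F Z c') : ¬ Dominates H φ Z F' X c'' := by
  intro h''
  obtain ⟨x, hx, hcx⟩ := h.exists_color_eq hE 0
  obtain ⟨y, hy, hcy⟩ := h'.exists_color_eq hF 1
  obtain ⟨z, hz, hcz⟩ := h''.exists_color_eq hF' 0
  obtain ⟨x', hx', hcx'⟩ := h.exists_color_eq hE 1
  obtain ⟨y', hy', hcy'⟩ := h'.exists_color_eq hF 0
  obtain ⟨z', hz', hcz'⟩ := h''.exists_color_eq hF' 1
  obtain ⟨e₁, l₁, k₁⟩ := h.isCrossColouring.exists_isLink hx hy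
  obtain ⟨e₂, l₂, k₂⟩ := h'.isCrossColouring.exists_isLink hy hz
  obtain ⟨e₃, l₃, k₃⟩ := h''.isCrossColouring.exists_isLink hz hx'
  obtain ⟨e₄, l₄, k₄⟩ := h.isCrossColouring.exists_isLink hx' hy'
  obtain ⟨e₅, l₅, k₅⟩ := h'.isCrossColouring.exists_isLink hy' hz'
  obtain ⟨e₆, l₆, k₆⟩ := h''.isCrossColouring.exists_isLink hz' hx
  have hcycle : IsAltWalk H φ x 0 [(e₁, y), (e₂, z), (e₃, x'), (e₄, y'), (e₅, z'), (e₆, x)] x 0 :=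
    ⟨l₁, k₁.trans hcx, l₂, k₂.trans hcy, l₃, k₃.trans hcz, l₄, k₄.trans hcx', l₅, k₅.trans hcy',
      l₆, k₆.trans hcz', l₁.left_mem, rfl, rfl⟩
  have hne : ∀ {d : α → Fin 2} {w w'}, d w = 0 → d w' = 1 → w ≠ w' := by
    rintro d w _ h₀ h₁ rfl
    exact zero_ne_one (h₀.symm.trans h₁)
  refine hP.not_isAltWalk (List.cons_ne_nil _ _) ?_ ?_ hcycle
  · have ne_XY {x y} : x ∈ X → y ∈ Y → x ≠ y := hP.ne_of_mem hX hY hXY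
    have ne_YZ {y z} : y ∈ Y → z ∈ Z → y ≠ z := hP.ne_of_mem hY hZ hYZ
    have ne_ZX {z x} : z ∈ Z → x ∈ X → z ≠ x := hP.ne_of_mem hZ hX hZX
    simp [ne_YZ hy hz, ne_YZ hy hz', ne_YZ hy' hz', (ne_YZ hy' hz).symm, ne_ZX hz hx, ne_ZX hz hx',
      ne_ZX hz' hx, (ne_ZX hz' hx').symm, ne_XY hx' hy', (ne_XY hx hy).symm, (ne_XY hx hy').symm,
      (ne_XY hx' hy).symm, (hne hcx hcx').symm, (hne hcy' hcy).symm, hne hcz hcz']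
  · simp only [List.forall_mem_cons]
    exact ⟨⟨Y, hY, hy, x, hP.notMem hX hY hXY hx, l₁⟩, ⟨Z, hZ, hz, y, hP.notMem hY hZ hYZ hy, l₂⟩,
      ⟨X, hX, hx', z, hP.notMem hZ hX hZX hz, l₃⟩, ⟨Y, hY, hy', x', hP.notMem hX hY hXY hx', l₄⟩,
      ⟨Z, hZ, hz', y', hP.notMem hY hZ hYZ hy', l₅⟩, ⟨X, hX, hx, z', hP.notMem hZ hX hZX hz', l₆⟩,
      by simp⟩

lemma exists_dominates (hH : IsExtendedComplete H φ κ) (hP : IsIrreducibleFactor H φ P)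
    (hnt : P.Nontrivial) :
    ∃ X ∈ P, ∃ F c, HasClosedTrail H φ X F ∧ Dominates H φ X F (V(H) \ X) c := by
  choose! F hF using hP.supereulerianOn
  have hdom : ∃ X ∈ P, ∀ Y ∈ P, Y ≠ X → ∃ c, Dominates H φ X (F X) Y c := by
    refine exists_forall_of_no_cyclic_triple hP.finite hnt.nonempty (fun X hX Y hY hXY => ?_) ?_
    · exact hH.dominates_or_dominates (hF X hX) (hF Y hY) (hP.pairwiseDisjoint hX hY hXY)
        (hP.not_supereulerianOn_union hX hY hXY)
    · rintro X hX Y hY Z hZ hXY hYZ hZX ⟨c, h⟩ ⟨c', h'⟩ ⟨c'', h''⟩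
      exact hP.not_dominates_of_dominates_of_dominates hX hY hZ hXY hYZ hZX (hF X hX) (hF Y hY)
        (hF Z hZ) h h' h''
  obtain ⟨X, hX, hdom⟩ := hdom
  obtain ⟨Y, hY, hYX⟩ := hnt.exists_ne X
  obtain ⟨c, hc⟩ := hdom Y hY hYX
  refine ⟨X, hX, F X, c, hF X hX, ⟨fun x hx z hz => ?_, hc.alternates⟩⟩
  obtain ⟨Z, hZ, hzZ⟩ := hP.sUnion_eq.symm ▸ hz.1
  have hZX : Z ≠ X := fun h => hz.2 (h ▸ hzZ)
  obtain ⟨c', hc'⟩ := hdom Z hZ hZX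
  have hcolor := hP.color_eq_of_dominates hX hY hZ hYX.symm hZX.symm (hF X hX) hc hc' hx
  obtain ⟨hadj, hcol⟩ := hc'.isCrossColouring x hx z hzZ
  exact ⟨hadj, fun e he => (hcol e he).trans hcolor⟩

theorem subsingleton (hH : IsExtendedComplete H φ κ) (hP : IsIrreducibleFactor H φ P)
    (hreach : ∀ u ∈ V(H), ∀ v ∈ V(H), u ≠ v → ∀ b, ∃ a p, IsAltWalk H φ u a p v b) :
    P.Subsingleton := by
  by_contra hnt
  rw [Set.not_subsingleton_iff] at hnt
  obtain ⟨X, hX, F, c, hF, hc⟩ := hP.exists_dominates hH hnt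
  obtain ⟨Y, hY, hYX⟩ := hnt.exists_ne X
  have hXY : Disjoint X Y := hP.pairwiseDisjoint hX hY hYX.symm
  obtain ⟨F', hF'⟩ := hP.supereulerianOn Y hY
  obtain ⟨x, hx⟩ := hF.nonempty
  obtain ⟨y, hy⟩ := hF'.nonempty
  obtain ⟨a, p, hp⟩ := hreach y (hF'.subset_vertexSet hy) x (hF.subset_vertexSet hx)
    (hXY.ne_of_mem hx hy).symm (c x)
  obtain ⟨v, hv, v', hv', e, hl, hcv, he⟩ :=
    hc.exists_chord hp (fun hyX => absurd hy (Set.disjoint_left.1 hXY hyX)) hx rfl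
  have hYsub : Y ⊆ V(H) \ X := Set.subset_sdiff.2 ⟨hF'.subset_vertexSet, hXY.symm⟩
  exact hP.not_supereulerianOn_union hX hY hYX.symm
    ((hc.mono hYsub).supereulerianOn_union_of_chord hF hF' hXY hv hv' (hH.vertex_ne hl) hl
      hcv he)

end IsIrreducibleFactor

theorem IsExtendedComplete.supereulerianOn_vertexSet (hH : IsExtendedComplete H φ κ)
    (hV : V(H).Nonempty) (hP : IsEulerianFactor H φ P)
    (hreach : ∀ u ∈ V(H), ∀ v ∈ V(H), u ≠ v → ∀ b, ∃ a p, IsAltWalk H φ u a p v b) :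
    SupereulerianOn H φ V(H) := by
  obtain ⟨Q, hQ⟩ := hP.exists_isIrreducibleFactor
  rcases (hQ.subsingleton hH hreach).eq_empty_or_singleton with rfl | ⟨X, rfl⟩
  · exact absurd hV (by simp [← hQ.sUnion_eq])
  · rw [← hQ.sUnion_eq, Set.sUnion_singleton]
    exact hQ.supereulerianOn X rfl

end Factors

section Main

variable {α β γ : Type*} {H : Graph α β} {φ : β → Fin 2} {κ : α → γ} {u v : α} {a b : Fin 2}
  {p : List (β × α)} {X : Set α}

lemma supereulerian_iff_supereulerianOn : Supereulerian H φ ↔ SupereulerianOn H φ V(H) := by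
  constructor
  · rintro ⟨u, p, ⟨hp, hn⟩, hc, hV⟩
    obtain ⟨a, ha⟩ := exists_isAltWalk_of_alternatesCyclically hp hc
    have hne : p ≠ [] := by
      rintro rfl
      exact hc.2 rfl
    exact ⟨_, u, a, p, hne, ha, hn,
      fun w => ⟨fun hw => ha.mem_vertexSet (List.mem_cons_of_mem _ hw), hV w⟩, fun _ => Iff.rfl⟩
  · rintro ⟨F, u, a, p, hp⟩
    exact ⟨u, p, ⟨hp.walk.isWalk, hp.nodup⟩, hp.walk.alternatesCyclically hp.ne_nil,
      fun v => (hp.mem_vertices v).2⟩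

lemma IsAltWalk.of_induce (h : IsAltWalk (H.induce X) φ u a p v b) (hX : X ⊆ V(H)) :
    IsAltWalk H φ u a p v b := by
  induction p generalizing u a with
  | nil => exact ⟨hX h.1, h.2⟩
  | cons d p ih => exact ⟨h.1.1, h.2.1, ih h.2.2⟩

lemma supereulerianOn_of_induce (h : Supereulerian (H.induce X) φ) (hX : X ⊆ V(H)) :
    SupereulerianOn H φ X := by
  obtain ⟨F, u, a, p, hp⟩ := supereulerian_iff_supereulerianOn.1 h
  exact ⟨F, u, a, p, { hp with walk := hp.walk.of_induce hX }⟩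

lemma HasEulerianFactor.exists_isEulerianFactor (h : HasEulerianFactor H φ) :
    ∃ P, IsEulerianFactor H φ P := by
  obtain ⟨k, X, hdisj, hcover, hX⟩ := h
  refine ⟨Set.range X, Set.finite_range X, ?_, hcover, ?_⟩
  · rintro _ ⟨i, rfl⟩ _ ⟨j, rfl⟩ hij
    exact hdisj fun h => hij (congrArg X h)
  · rintro _ ⟨i, rfl⟩
    exact supereulerianOn_of_induce (hX i) (hcover ▸ Set.subset_iUnion X i)

lemma Supereulerian.hasEulerianFactor (h : Supereulerian H φ) : HasEulerianFactor H φ :=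
  ⟨1, fun _ => V(H), Subsingleton.pairwise, Set.iUnion_const _, fun _ => by
    rwa [Graph.induce_vertexSet]⟩

lemma HasAltPath.exists_of_forall (huv : ∀ a, ∃ b, HasAltPath H φ u a v b)
    (hvu : ∀ a, ∃ b, HasAltPath H φ v a u b) :
    ∃ a b, HasAltPath H φ u a v b ∧ HasAltPath H φ u (a + 1) v (b + 1) := by
  obtain ⟨b, hb⟩ := huv 0
  obtain ⟨c, hc⟩ := huv (0 + 1)
  rcases eq_or_eq_add_one c b with rfl | rfl
  · obtain ⟨d, hd⟩ := hvu c
    refine ⟨d, c, ?_, hd.symm⟩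
    rcases eq_or_eq_add_one d 0 with rfl | rfl
    exacts [hb, hc]
  · exact ⟨0, b, hb, hc⟩

lemma SupereulerianOn.colourConnected (hH : IsExtendedComplete H φ κ)
    (h : SupereulerianOn H φ V(H)) : ColourConnected H φ := by
  obtain ⟨F, hF⟩ := h
  have reach : ∀ {u v}, u ∈ V(H) → v ∈ V(H) → ∀ a, ∃ b, HasAltPath H φ u a v b := by
    intro u v hu hv a
    obtain ⟨p, hp⟩ := hF.exists_isClosedTrail hu a
    obtain ⟨s, t, c, -, hs, -⟩ := hp.walk.exists_append_of_mem_support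
      (List.mem_cons_of_mem _ ((hp.mem_vertices v).2 hv))
    exact hH.exists_hasAltPath hs
  intro u hu v hv huv
  obtain ⟨a, b, ⟨p, hp, hpn⟩, q, hq, hqn⟩ :=
    HasAltPath.exists_of_forall (reach hu hv) (reach hv hu)
  refine ⟨p, q, ⟨hp.isWalk, hpn⟩, hp.alternates_colours,
    ⟨hq.isWalk, hqn⟩, hq.alternates_colours, ?_⟩
  have hne : p ≠ [] := by
    rintro rfl
    exact huv hp.2.1
  have hclosed := hp.append (by simpa only [add_one_add_one] using hq.reverse)
  have hcolours : colours φ (p ++ reverseWalk u q) = colours φ p ++ (colours φ q).reverse := by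
    rw [← colours_reverseWalk]
    exact List.map_append
  exact hcolours ▸ hclosed.alternatesCyclically (List.append_ne_nil_of_left_ne_nil hne _)

lemma ColourConnected.exists_isAltWalk (h : ColourConnected H φ) (hu : u ∈ V(H)) (hv : v ∈ V(H))
    (huv : u ≠ v) (b : Fin 2) : ∃ a p, IsAltWalk H φ u a p v b := by
  obtain ⟨p, q, ⟨hp, -⟩, hpc, ⟨hq, -⟩, hqc, hpq⟩ := h u hu v hv huv
  obtain ⟨a, c, hp⟩ := TwoEdgeColoured.exists_isAltWalk hp hpc
  obtain ⟨a', c', hq⟩ := TwoEdgeColoured.exists_isAltWalk hq hqc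
  have hp0 : p ≠ [] := by
    rintro rfl
    exact huv hp.2.1
  have hq0 : q ≠ [] := by
    rintro rfl
    exact huv hq.2.1
  have hcc : c ≠ c' := by
    rintro rfl
    refine (List.isChain_append.1 hpq.1).2.2 (c + 1) (hp.getLast?_colours hp0) (c + 1) ?_ rfl
    rw [List.head?_reverse]
    exact hq.getLast?_colours hq0
  rcases eq_or_eq_add_one b c with rfl | rfl
  · exact ⟨a, p, hp⟩
  · exact ⟨a', q, ne_iff_eq_add_one.1 hcc.symm ▸ hq⟩

lemma isExtendedComplete_extension {G : Graph α β} (hG : IsComplete G) (φ : β → Fin 2)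
    (p : α → ℕ) : IsExtendedComplete (extension G p) (extensionColouring φ p) Sigma.fst where
  ne {e x y} h hxy := by
    obtain ⟨-, hl⟩ := h
    have hloopless := hG.1
    exact hloopless.not_isLoopAt e.1 x.1 (by rwa [← hxy] at hl)
  adj {x y} hx hy hxy := by
    obtain ⟨e, he⟩ := hG.2 _ hx _ hy hxy
    exact ⟨(e, s(x, y)), rfl, he⟩
  twin {e x y z} h _ hzx := ⟨(e.1, s(z, y)), ⟨rfl, hzx ▸ h.2⟩, rfl⟩

end Main

end TwoEdgeColoured

theorem mainTheorem3_general {α β γ : Type*} {H : Graph α β} {φ : β → Fin 2} {κ : α → γ}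
    (hH : TwoEdgeColoured.IsExtendedComplete H φ κ) (hV : V(H).Nonempty) :
    TwoEdgeColoured.Supereulerian H φ ↔
      TwoEdgeColoured.HasEulerianFactor H φ ∧ TwoEdgeColoured.ColourConnected H φ := by
  constructor
  · intro h
    have hspan := TwoEdgeColoured.supereulerian_iff_supereulerianOn.1 h
    exact ⟨h.hasEulerianFactor, hspan.colourConnected hH⟩
  · rintro ⟨hfactor, hconn⟩
    obtain ⟨P, hP⟩ := hfactor.exists_isEulerianFactor
    exact TwoEdgeColoured.supereulerian_iff_supereulerianOn.2
      (hH.supereulerianOn_vertexSet hV hP fun u hu v hv => hconn.exists_isAltWalk hu hv)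

theorem mainTheorem3 {α β : Type*} (G : Graph α β) (φ : β → Fin 2)
    (hV : V(G).Finite) (hE : E(G).Finite) (hn : V(G).Nontrivial)
    (hG : TwoEdgeColoured.IsComplete G)
    (p : α → ℕ) (hp : ∀ v ∈ V(G), 1 ≤ p v) :
    TwoEdgeColoured.Supereulerian (TwoEdgeColoured.extension G p)
        (TwoEdgeColoured.extensionColouring φ p) ↔
      TwoEdgeColoured.HasEulerianFactor (TwoEdgeColoured.extension G p)
          (TwoEdgeColoured.extensionColouring φ p) ∧
        TwoEdgeColoured.ColourConnected (TwoEdgeColoured.extension G p)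
          (TwoEdgeColoured.extensionColouring φ p) := by
  obtain ⟨v, hv⟩ := hn.nonempty
  exact mainTheorem3_general (TwoEdgeColoured.isExtendedComplete_extension hG φ p)
    ⟨⟨v, 0, hp v hv⟩, hv⟩
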